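/- **Theorem 1.3.** Let $K$ be a convex body in $\mathbb R^d$ (a compact convex set with non-empty interior) and let $p\in\operatorname{int}K$. A *Minkowski arrangement of $K$ with respect to $p$* is a family $\{v_i+\lambda_iK\}$ with $v_i\in\mathbb R^d$, $\lambda_i>0$, such that $v_i+\lambda_ip\notin v_j+\lambda_j\operatorname{int}K$ for all distinct $i,j$; it is *strict* if moreover $v_i+\lambda_ip\notin v_j+\lambda_jK$ for all distinct $i,j$. Let $\kappa(K,p)$ (respectively $\kappa'(K,p)$) be the largest number of homothets in a pairwise intersecting Minkowski arrangement (respectively strict Minkowski arrangement) of $K$ with respect to $p$, and let $$\theta(K,p)=\inf\{\theta\ge 0:\ p-K\subseteq\theta(K-p)\}.$$ Then $\kappa'(K,p)\le\kappa(K,p)$. Moreover there is an absolute constant $C>0$ such that for every $d\ge2$, every convex body $K$ in $\mathbb R^d$ and every $p\in\operatorname{int}K$, the number $\kappa(K,p)$ is finite and $$\kappa(K,p)\le\left(\frac32\right)^d\frac{\operatorname{vol}(K-K)}{\operatorname{vol}\bigl((K-p)\cap(p-K)\bigr)}\cdot C\,d\,\bigl(\log d+\log\theta(K,p)\bigr),$$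 and there is an absolute constant $C>0$ such that for every $d\ge2$ and every convex body $K$ in $\mathbb R^d$ with centroid $c$, $$\kappa'(K,c)\le\kappa(K,c)\le 3^d\binom{2d}{d}\cdot C\,d\log d .$$ -/

import Mathlib

open MeasureTheory
open scoped Pointwise

/-- The family of positive homothets `v i + l i • K` is a Minkowski arrangement of `K` with respect
to `p`: the reference point `v i + l i • p` of any homothet is not in the interior
`v j + l j • interior K` of any other homothet. -/
structure IsMinkowskiArrangement {E : Type*} [NormedAddCommGroup E] [NormedSpace ℝ E]
    (K : Set E) (p : E) {ι : Type*} (v : ι → E) (l : ι → ℝ) : Prop where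
  pos : ∀ i, 0 < l i
  notMem : ∀ i j, i ≠ j → v i + l i • p ∉ v j +ᵥ l j • interior K

/-- The family of positive homothets `v i + l i • K` is a strict Minkowski arrangement of `K` with
respect to `p`: the reference point `v i + l i • p` of any homothet is not in any other homothet. -/
structure IsStrictMinkowskiArrangement {E : Type*} [NormedAddCommGroup E] [NormedSpace ℝ E]
    (K : Set E) (p : E) {ι : Type*} (v : ι → E) (l : ι → ℝ) : Prop where
  pos : ∀ i, 0 < l i
  notMem : ∀ i j, i ≠ j → v i + l i • p ∉ v j +ᵥ l j • K

/-- Any two of the homothets `v i + l i • K` have a common point. -/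
def PairwiseIntersecting {E : Type*} [NormedAddCommGroup E] [NormedSpace ℝ E]
    (K : Set E) {ι : Type*} (v : ι → E) (l : ι → ℝ) : Prop :=
  ∀ i j, i ≠ j → ((v i +ᵥ l i • K) ∩ (v j +ᵥ l j • K)).Nonempty

/-- `κ(K, p)`: the largest number (`⊤` if there is no largest) of homothets in a pairwise
intersecting Minkowski arrangement of `K` with respect to `p`. -/
noncomputable def kappa {E : Type*} [NormedAddCommGroup E] [NormedSpace ℝ E]
    (K : Set E) (p : E) : ℕ∞ :=
  sSup {N : ℕ∞ | ∃ (ι : Type) (v : ι → E) (l : ι → ℝ),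
    IsMinkowskiArrangement K p v l ∧ PairwiseIntersecting K v l ∧ N = ENat.card ι}

/-- `κ'(K, p)`: the largest number (`⊤` if there is no largest) of homothets in a pairwise
intersecting strict Minkowski arrangement of `K` with respect to `p`. -/
noncomputable def kappaStrict {E : Type*} [NormedAddCommGroup E] [NormedSpace ℝ E]
    (K : Set E) (p : E) : ℕ∞ :=
  sSup {N : ℕ∞ | ∃ (ι : Type) (v : ι → E) (l : ι → ℝ),
    IsStrictMinkowskiArrangement K p v l ∧ PairwiseIntersecting K v l ∧ N = ENat.card ι}

/-- The measure of asymmetry `θ(K, p) = inf {t ≥ 0 : p - K ⊆ t (K - p)}`. -/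
noncomputable def asymmetry {E : Type*} [NormedAddCommGroup E] [NormedSpace ℝ E]
    (K : Set E) (p : E) : ℝ :=
  sInf {t : ℝ | 0 ≤ t ∧ {p} - K ⊆ t • (K - {p})}

/-- The centroid `(1 / vol K) ∫_K x dx` of `K`. -/
noncomputable def centroidOf {d : ℕ} (K : Set (EuclideanSpace ℝ (Fin d))) :
    EuclideanSpace ℝ (Fin d) :=
  ⨍ x in K, x

/-!
Everything is translated so that the reference point `p` becomes the origin; put `S = K ∩ -K`.
The reference points `x i` of a Minkowski arrangement whose ratios all lie in `[α, (1 + 1 / d) α]`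
are pairwise separated: the gauge of `K` is at least `α` at all differences `x i - x j`. Hence the
translates `x i + (α / 2) • S` do not overlap. As the homothets intersect pairwise, the difference
body of the union of these translates lies in `(3 / 2 + 1 / d) α • (K - K)`, and the Brunn–Minkowski
inequality `2 ^ d * vol A ≤ vol (A - A)` bounds the number of homothets by
`(3 / 2 + 1 / d) ^ d * vol (K - K) / vol S` (`card_mul_volume_le_of_separated`,
`card_mul_volume_le_of_ratio_mem_Icc`).

About `d * log (d θ)` such classes cover all ratios up to `d θ` times the smallest one. The homothets
with larger ratios need only one more class. Rescaled to ratio `1` about the reference point of the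
smallest homothet, their reference points lie in `(1 + 1 / d) • K` up to sign, and they are still
separated, with gauge at least `1 - 1 / d`, so the same packing argument applies
(`card_mul_volume_le_of_ratio_large`). The sum over all classes is
`card_mul_volume_le_of_arrangement`. It bounds the cardinality of every finite subfamily, so that
`kappa K p` is finite.

If `p` is the centroid, three estimates turn this into an absolute bound: the Rogers–Shephard
inequality `vol (K - K) ≤ (2d choose d) * vol K` (`volume_real_sub_self_le`), the Milman–Pajor
inequality `vol K ≤ 2 ^ d * vol S` (`volume_real_le_two_pow_mul_inter_neg`), and `θ ≤ 2 d`
(`neg_subset_two_mul_smul`).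

The Brunn–Minkowski inequality is needed in its multiplicative form (`volume_rpow_mul_rpow_le`),
both for unions of convex sets and for the log-concavity of `x ↦ vol (K ∩ (x - K))`. It is deduced
from the Prékopa–Leindler inequality, which is proved by induction on the dimension.
-/

open Set Filter Topology
open scoped ENNReal

/-! ### The Prékopa–Leindler and Brunn–Minkowski inequalities -/

/-- The Prékopa–Leindler inequality for the volume of `E`. -/
def PrekopaLeindler (E : Type*) [AddCommGroup E] [Module ℝ E] [MeasureSpace E] : Prop :=
  ∀ ⦃a b : ℝ⦄, 0 < a → 0 < b → a + b = 1 → ∀ f g h : E → ℝ≥0∞,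
    Measurable f → Measurable g → Measurable h →
    (∀ x y, f x ^ a * g y ^ b ≤ h (a • x + b • y)) →
    (∫⁻ x, f x) ^ a * (∫⁻ x, g x) ^ b ≤ ∫⁻ x, h x

theorem ENNReal.geom_mean_le_arith_mean2_weighted' {a b : ℝ} (ha : 0 < a) (hb : 0 < b)
    (hab : a + b = 1) (x y : ℝ≥0∞) :
    x ^ a * y ^ b ≤ ENNReal.ofReal a * x + ENNReal.ofReal b * y := by
  have hpq : (a⁻¹).HolderConjugate b⁻¹ := Real.HolderConjugate.inv_inv ha hb hab
  have h := ENNReal.young_inequality (x ^ a) (y ^ b) hpq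
  rw [← ENNReal.rpow_mul, ← ENNReal.rpow_mul, mul_inv_cancel₀ ha.ne', mul_inv_cancel₀ hb.ne',
    ENNReal.rpow_one, ENNReal.rpow_one, ENNReal.ofReal_inv_of_pos ha,
    ENNReal.ofReal_inv_of_pos hb, div_eq_mul_inv, div_eq_mul_inv, inv_inv, inv_inv,
    mul_comm x, mul_comm y] at h
  exact h

/-- The one-dimensional Brunn–Minkowski inequality for compact sets: `a • A` and `b • B` can be
translated so that they lie in `a • A + b • B` and share at most one point. -/
theorem volume_add_le_of_isCompact {a b : ℝ} (ha : 0 < a) (hb : 0 < b) {A B C : Set ℝ}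
    (hA : IsCompact A) (hB : IsCompact B) (hA0 : A.Nonempty) (hB0 : B.Nonempty)
    (h : ∀ x ∈ A, ∀ y ∈ B, a * x + b * y ∈ C) :
    ENNReal.ofReal a * volume A + ENNReal.ofReal b * volume B ≤ volume C := by
  obtain ⟨α, hαA, hα⟩ := hA.exists_isGreatest hA0
  obtain ⟨β, hβB, hβ⟩ := hB.exists_isLeast hB0
  have hvol : ∀ (r : ℝ) (_ : 0 < r) (s : Set ℝ) (c : ℝ),
      volume ((fun x => r * x + c) '' s) = ENNReal.ofReal r * volume s := by
    intro r hr s c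
    have : (fun x => r * x + c) '' s = (fun x => x + c) '' (r • s) := by
      rw [← image_smul, image_image]; rfl
    rw [this, image_add_right, measure_preimage_add_right, Measure.addHaar_smul]
    simp [abs_of_pos hr]
  have hQ : MeasurableSet ((fun x => b * x + a * α) '' B) :=
    (hB.image (by fun_prop)).measurableSet
  have hI : volume (((fun x => a * x + b * β) '' A) ∩ ((fun x => b * x + a * α) '' B)) = 0 := by
    refine measure_mono_null (t := {a * α + b * β}) ?_ (by simp)
    rintro _ ⟨⟨x, hx, rfl⟩, ⟨y, hy, hxy⟩⟩
    have h1 := hα hx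
    have h2 := hβ hy
    simp only at hxy
    have h3 : a * x ≤ a * α := by gcongr
    have h4 : b * β ≤ b * y := by gcongr
    simp only [mem_singleton_iff]
    linarith
  rw [← hvol a ha A (b * β), ← hvol b hb B (a * α), ← measure_union_add_inter _ hQ, hI, add_zero]
  refine measure_mono ?_
  rintro _ (⟨x, hx, rfl⟩ | ⟨y, hy, rfl⟩)
  · exact h x hx β hβB
  · have := h α hαA y hy
    rwa [add_comm] at this

theorem mul_volume_add_le_of_forall_isCompact {a : ℝ} (ha : 0 < a) {A : Set ℝ}
    (hA : MeasurableSet A) {c M : ℝ≥0∞}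
    (h : ∀ L ⊆ A, IsCompact L → ENNReal.ofReal a * volume L + c ≤ M) :
    ENNReal.ofReal a * volume A + c ≤ M := by
  have ha' : ENNReal.ofReal a ≠ 0 := by simpa using ha
  by_cases hc : c = ∞
  · have := h ∅ (empty_subset _) isCompact_empty
    simp_all
  · have hcM : c ≤ M := by simpa using h ∅ (empty_subset _) isCompact_empty
    refine add_le_of_le_tsub_right_of_le hcM ?_
    rw [mul_comm, ← ENNReal.le_div_iff_mul_le (.inl ha') (.inl ENNReal.ofReal_ne_top),
      hA.measure_eq_iSup_isCompact]
    refine iSup_le fun L => iSup_le fun hL => iSup_le fun hLc => ?_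
    rw [ENNReal.le_div_iff_mul_le (.inl ha') (.inl ENNReal.ofReal_ne_top), mul_comm]
    exact ENNReal.le_sub_of_add_le_right hc (h L hL hLc)

/-- The one-dimensional Brunn–Minkowski inequality for measurable sets. -/
theorem volume_add_le_of_measurableSet {a b : ℝ} (ha : 0 < a) (hb : 0 < b) {A B C : Set ℝ}
    (hA : MeasurableSet A) (hB : MeasurableSet B) (hA0 : A.Nonempty) (hB0 : B.Nonempty)
    (h : ∀ x ∈ A, ∀ y ∈ B, a * x + b * y ∈ C) :
    ENNReal.ofReal a * volume A + ENNReal.ofReal b * volume B ≤ volume C := by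
  obtain ⟨x₀, hx₀⟩ := hA0
  obtain ⟨y₀, hy₀⟩ := hB0
  refine mul_volume_add_le_of_forall_isCompact ha hA fun K hK hKc => ?_
  rw [add_comm]
  refine mul_volume_add_le_of_forall_isCompact hb hB fun L hL hLc => ?_
  rw [add_comm]
  -- the extra points make the compact sets nonempty
  calc ENNReal.ofReal a * volume K + ENNReal.ofReal b * volume L
      ≤ ENNReal.ofReal a * volume (insert x₀ K) + ENNReal.ofReal b * volume (insert y₀ L) := by
        gcongr <;> exact subset_insert _ _
    _ ≤ volume C := volume_add_le_of_isCompact ha hb (hKc.insert _) (hLc.insert _)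
        (insert_nonempty _ _) (insert_nonempty _ _) fun x hx y hy =>
          h x (insert_subset hx₀ hK hx) y (insert_subset hy₀ hL hy)

theorem lintegral_eq_lintegral_meas_ofReal_lt {f : ℝ → ℝ≥0∞} (hf : Measurable f)
    (hf' : ∀ x, f x ≠ ∞) :
    ∫⁻ x, f x = ∫⁻ t in Ioi (0 : ℝ), volume {x | ENNReal.ofReal t < f x} := by
  have h := lintegral_eq_lintegral_meas_lt (volume : Measure ℝ) (f := fun x => (f x).toReal)
    (ae_of_all _ fun x => ENNReal.toReal_nonneg) hf.ennreal_toReal.aemeasurable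
  simp only [ENNReal.ofReal_toReal (hf' _)] at h
  rw [h]
  refine setLIntegral_congr_fun measurableSet_Ioi fun t ht => ?_
  simp only [ENNReal.ofReal_lt_iff_lt_toReal (le_of_lt ht) (hf' _)]

/-- The Prékopa–Leindler inequality on the line for functions with supremum `1`: the superlevel
sets of `f` and `g` at a common height below `1` are nonempty, so the one-dimensional
Brunn–Minkowski inequality applies to them. -/
theorem lintegral_prekopaLeindler_of_iSup_eq_one {a b : ℝ} (ha : 0 < a) (hb : 0 < b)
    (hab : a + b = 1) {f g h : ℝ → ℝ≥0∞} (hf : Measurable f) (hg : Measurable g)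
    (hh : Measurable h) (hf1 : ⨆ x, f x = 1) (hg1 : ⨆ x, g x = 1)
    (H : ∀ x y, f x ^ a * g y ^ b ≤ h (a • x + b • y)) :
    (∫⁻ x, f x) ^ a * (∫⁻ x, g x) ^ b ≤ ∫⁻ x, h x := by
  have hfle : ∀ x, f x ≤ 1 := fun x => hf1 ▸ le_iSup f x
  have hgle : ∀ x, g x ≤ 1 := fun x => hg1 ▸ le_iSup g x
  have hmin : ∀ x, min (h x) 1 ≠ ∞ := fun x => (min_le_right _ _).trans_lt ENNReal.one_lt_top |>.ne
  refine (ENNReal.geom_mean_le_arith_mean2_weighted' ha hb hab _ _).trans ?_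
  refine le_trans ?_ (lintegral_mono fun x => min_le_left (h x) 1)
  rw [lintegral_eq_lintegral_meas_ofReal_lt hf fun x => ((hfle x).trans_lt ENNReal.one_lt_top).ne,
    lintegral_eq_lintegral_meas_ofReal_lt hg fun x => ((hgle x).trans_lt ENNReal.one_lt_top).ne,
    lintegral_eq_lintegral_meas_ofReal_lt (hh.min measurable_const) hmin,
    ← lintegral_const_mul' _ _ ENNReal.ofReal_ne_top,
    ← lintegral_const_mul' _ _ ENNReal.ofReal_ne_top]
  refine (le_lintegral_add _ _).trans (setLIntegral_mono' measurableSet_Ioi fun t ht => ?_)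
  rcases lt_or_ge t 1 with ht1 | ht1
  · have ht1' : ENNReal.ofReal t < 1 := by simpa using ht1
    have hfne : {x | ENNReal.ofReal t < f x}.Nonempty := by
      obtain ⟨x, hx⟩ := lt_iSup_iff.1 (ht1'.trans_eq hf1.symm)
      exact ⟨x, hx⟩
    have hgne : {x | ENNReal.ofReal t < g x}.Nonempty := by
      obtain ⟨x, hx⟩ := lt_iSup_iff.1 (ht1'.trans_eq hg1.symm)
      exact ⟨x, hx⟩
    refine volume_add_le_of_measurableSet ha hb (measurableSet_lt measurable_const hf)
      (measurableSet_lt measurable_const hg) hfne hgne fun x hx y hy => ?_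
    have hx' : ENNReal.ofReal t < f x := hx
    have hy' : ENNReal.ofReal t < g y := hy
    have hpos : ENNReal.ofReal t ≠ 0 := by simpa using ht
    refine lt_min ?_ ht1'
    calc ENNReal.ofReal t = ENNReal.ofReal t ^ a * ENNReal.ofReal t ^ b := by
          rw [← ENNReal.rpow_add _ _ hpos ENNReal.ofReal_ne_top, hab, ENNReal.rpow_one]
      _ < f x ^ a * g y ^ b := by
          refine ENNReal.mul_lt_mul (ENNReal.rpow_lt_rpow hx' ha) (ENNReal.rpow_lt_rpow hy' hb)
      _ ≤ _ := H x y
  · have h1 : (1 : ℝ≥0∞) ≤ ENNReal.ofReal t := by simpa using ht1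
    have hfe : {x | ENNReal.ofReal t < f x} = ∅ :=
      eq_empty_of_forall_notMem fun x hx => ((hfle x).trans h1).not_gt hx
    have hge : {x | ENNReal.ofReal t < g x} = ∅ :=
      eq_empty_of_forall_notMem fun x hx => ((hgle x).trans h1).not_gt hx
    simp [hfe, hge]

theorem lintegral_prekopaLeindler_of_iSup_ne_top {a b : ℝ} (ha : 0 < a) (hb : 0 < b)
    (hab : a + b = 1) {f g h : ℝ → ℝ≥0∞} (hf : Measurable f) (hg : Measurable g)
    (hh : Measurable h) (hf1 : ⨆ x, f x ≠ ∞) (hg1 : ⨆ x, g x ≠ ∞)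
    (H : ∀ x y, f x ^ a * g y ^ b ≤ h (a • x + b • y)) :
    (∫⁻ x, f x) ^ a * (∫⁻ x, g x) ^ b ≤ ∫⁻ x, h x := by
  set M := ⨆ x, f x with hM
  set N := ⨆ x, g x with hN
  by_cases hM0 : M = 0
  · have : f = 0 := funext fun x => le_antisymm ((le_iSup f x).trans_eq hM0) zero_le
    simp [this, ha]
  by_cases hN0 : N = 0
  · have : g = 0 := funext fun x => le_antisymm ((le_iSup g x).trans_eq hN0) zero_le
    simp [this, hb]
  have hMi : M⁻¹ ≠ ∞ := ENNReal.inv_ne_top.2 hM0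
  have hNi : N⁻¹ ≠ ∞ := ENNReal.inv_ne_top.2 hN0
  set c := M⁻¹ ^ a * N⁻¹ ^ b with hc
  have hc0 : c ≠ 0 := mul_ne_zero (by simp [ENNReal.rpow_eq_zero_iff, hf1, hMi])
    (by simp [ENNReal.rpow_eq_zero_iff, hg1, hNi])
  have hci : c ≠ ∞ := ENNReal.mul_ne_top (ENNReal.rpow_ne_top_of_nonneg ha.le hMi)
    (ENNReal.rpow_ne_top_of_nonneg hb.le hNi)
  have hprod : ∀ u v : ℝ≥0∞, (M⁻¹ * u) ^ a * (N⁻¹ * v) ^ b = c * (u ^ a * v ^ b) := by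
    intro u v
    rw [ENNReal.mul_rpow_of_nonneg _ _ ha.le, ENNReal.mul_rpow_of_nonneg _ _ hb.le, hc]
    ring
  have key := lintegral_prekopaLeindler_of_iSup_eq_one ha hb hab (f := fun x => M⁻¹ * f x)
    (g := fun x => N⁻¹ * g x) (h := fun x => c * h x) (hf.const_mul _) (hg.const_mul _)
    (hh.const_mul _) (by rw [← ENNReal.mul_iSup, ← hM, ENNReal.inv_mul_cancel hM0 hf1])
    (by rw [← ENNReal.mul_iSup, ← hN, ENNReal.inv_mul_cancel hN0 hg1])
    (fun x y => by rw [hprod]; gcongr; exact H x y)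
  rw [lintegral_const_mul' _ _ hMi, lintegral_const_mul' _ _ hNi, lintegral_const_mul' _ _ hci,
    hprod] at key
  exact (ENNReal.mul_le_mul_iff_right hc0 hci).1 key

theorem prekopaLeindler_real : PrekopaLeindler ℝ := by
  intro a b ha hb hab f g h hf hg hh H
  have hmono : ∀ u : ℝ → ℝ≥0∞, Measurable u →
      Tendsto (fun n : ℕ => ∫⁻ x, min (u x) n) atTop (𝓝 (∫⁻ x, u x)) := by
    intro u hu
    refine lintegral_tendsto_of_tendsto_of_monotone
      (fun n => (hu.min measurable_const).aemeasurable)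
      (ae_of_all _ fun x m n hmn => min_le_min_left _ (by exact_mod_cast hmn))
      (ae_of_all _ fun x => ?_)
    have : Tendsto (fun n : ℕ => min (u x) (n : ℝ≥0∞)) atTop (𝓝 (min (u x) ∞)) :=
      tendsto_const_nhds.min ENNReal.tendsto_nat_nhds_top
    simpa using this
  have hbd : ∀ n : ℕ, (∫⁻ x, min (f x) n) ^ a * (∫⁻ x, min (g x) n) ^ b ≤ ∫⁻ x, h x := by
    intro n
    have hs : ∀ u : ℝ → ℝ≥0∞, ⨆ x, min (u x) n ≠ ∞ := fun u =>
      ((iSup_le fun x => min_le_right _ _).trans_lt (ENNReal.natCast_lt_top n)).ne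
    refine lintegral_prekopaLeindler_of_iSup_ne_top ha hb hab (hf.min measurable_const)
      (hg.min measurable_const) hh (hs f) (hs g) fun x y => le_trans ?_ (H x y)
    gcongr <;> exact min_le_left _ _
  by_cases hF : ∫⁻ x, f x = 0
  · simp [hF, ha]
  by_cases hG : ∫⁻ x, g x = 0
  · simp [hG, hb]
  refine le_of_tendsto (ENNReal.Tendsto.mul ((hmono f hf).ennrpow_const a) (.inl ?_)
    ((hmono g hg).ennrpow_const b) (.inl ?_)) (Eventually.of_forall hbd)
  · simp [ENNReal.rpow_eq_zero_iff, hF, ha.not_gt]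
  · simp [ENNReal.rpow_eq_zero_iff, hG, hb.not_gt]

/-- The induction step in the dimension: by Fubini, integrate over the second factor first. -/
theorem PrekopaLeindler.prod {E F : Type*} [AddCommGroup E] [Module ℝ E] [MeasureSpace E]
    [AddCommGroup F] [Module ℝ F] [MeasureSpace F] [SFinite (volume : Measure F)]
    (hE : PrekopaLeindler E) (hF : PrekopaLeindler F) : PrekopaLeindler (E × F) := by
  intro a b ha hb hab f g h hf hg hh H
  rw [Measure.volume_eq_prod, lintegral_prod _ hf.aemeasurable, lintegral_prod _ hg.aemeasurable,
    lintegral_prod _ hh.aemeasurable]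
  refine hE ha hb hab _ _ _ hf.lintegral_prod_right' hg.lintegral_prod_right'
    hh.lintegral_prod_right' fun x y => ?_
  exact hF ha hb hab _ _ _ (hf.comp measurable_prodMk_left) (hg.comp measurable_prodMk_left)
    (hh.comp measurable_prodMk_left) fun z w => H (x, z) (y, w)

theorem PrekopaLeindler.of_measurePreserving {E F : Type*} [AddCommGroup E] [Module ℝ E]
    [MeasureSpace E] [AddCommGroup F] [Module ℝ F] [MeasureSpace F] (hE : PrekopaLeindler E)
    (e : E → F) (he : MeasurePreserving e)
    (hlin : ∀ (a b : ℝ) x y, e (a • x + b • y) = a • e x + b • e y) :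
    PrekopaLeindler F := by
  intro a b ha hb hab f g h hf hg hh H
  rw [← he.lintegral_comp hf, ← he.lintegral_comp hg, ← he.lintegral_comp hh]
  exact hE ha hb hab _ _ _ (hf.comp he.measurable) (hg.comp he.measurable)
    (hh.comp he.measurable) fun x y => by rw [hlin]; exact H _ _

theorem prekopaLeindler_pi (n : ℕ) : PrekopaLeindler (Fin n → ℝ) := by
  induction n with
  | zero =>
    intro a b ha hb hab f g h hf hg hh H
    simp only [volume_pi, Measure.pi_of_empty _ 0, lintegral_dirac]
    convert H 0 0
  | succ n ih =>
    refine (prekopaLeindler_real.prod ih).of_measurePreserving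
      (MeasurableEquiv.piFinSuccAbove (fun _ => ℝ) 0).symm
      (volume_preserving_piFinSuccAbove (fun _ => ℝ) 0).symm fun a b x y => ?_
    ext i
    refine Fin.cases ?_ (fun j => ?_) i <;> simp [MeasurableEquiv.piFinSuccAbove]

theorem prekopaLeindler_euclideanSpace (d : ℕ) : PrekopaLeindler (EuclideanSpace ℝ (Fin d)) :=
  (prekopaLeindler_pi d).of_measurePreserving (WithLp.toLp 2)
    (PiLp.volume_preserving_toLp (Fin d)) fun _ _ _ _ => rfl

/-- The multiplicative form of the Brunn–Minkowski inequality. -/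
theorem volume_rpow_mul_rpow_le {d : ℕ} {a b : ℝ} (ha : 0 < a) (hb : 0 < b) (hab : a + b = 1)
    {A B C : Set (EuclideanSpace ℝ (Fin d))} (hA : MeasurableSet A) (hB : MeasurableSet B)
    (hC : MeasurableSet C) (h : ∀ x ∈ A, ∀ y ∈ B, a • x + b • y ∈ C) :
    volume A ^ a * volume B ^ b ≤ volume C := by
  classical
  have key := prekopaLeindler_euclideanSpace d ha hb hab (A.indicator 1) (B.indicator 1)
    (C.indicator 1) (measurable_one.indicator hA) (measurable_one.indicator hB)
    (measurable_one.indicator hC) (fun x y => by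
      by_cases hx : x ∈ A
      · by_cases hy : y ∈ B
        · simp [hx, hy, h x hx y hy]
        · simp [hy, hb]
      · simp [hx, ha])
  rwa [lintegral_indicator_one hA, lintegral_indicator_one hB, lintegral_indicator_one hC] at key

/-! ### Packing separated points -/

theorem Convex.measure_interior {E : Type*} [NormedAddCommGroup E] [NormedSpace ℝ E]
    [MeasurableSpace E] [BorelSpace E] [FiniteDimensional ℝ E] {K : Set E} (hK : Convex ℝ K)
    (μ : Measure E) [μ.IsAddHaarMeasure] : μ (interior K) = μ K := by
  refine le_antisymm (measure_mono interior_subset) ?_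
  calc μ K ≤ μ (interior K ∪ frontier K) := by
        rw [← closure_eq_interior_union_frontier]
        exact measure_mono subset_closure
    _ ≤ μ (interior K) + μ (frontier K) := measure_union_le _ _
    _ = μ (interior K) := by rw [hK.addHaar_frontier μ, add_zero]

/-- A packing bound. The translates of `(δ / 2) • interior (K ∩ -K)` at the points `x i` are
disjoint; if `A` is their union, then `A - A ⊆ (r + δ / 2) • (K - K)`, whereas
`2 ^ d * vol A ≤ vol (A - A)` by the Brunn–Minkowski inequality. -/
theorem card_mul_volume_le_of_separated {d : ℕ} {K : Set (EuclideanSpace ℝ (Fin d))}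
    (hK : Convex ℝ K) (hKc : IsCompact K) (h0 : (0 : EuclideanSpace ℝ (Fin d)) ∈ interior K)
    {ι : Type*} (s : Finset ι) (x : ι → EuclideanSpace ℝ (Fin d)) {r δ : ℝ} (hr : 0 ≤ r)
    (hδ : 0 < δ) (hdiff : ∀ i ∈ s, ∀ j ∈ s, x i - x j ∈ r • (K - K))
    (hsep : ∀ i ∈ s, ∀ j ∈ s, i ≠ j → δ ≤ gauge K (x i - x j) ∨ δ ≤ gauge K (x j - x i)) :
    s.card * volume.real (K ∩ -K) ≤ (r / δ + 1 / 2) ^ d * volume.real (K - K) := by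
  have hKn : K ∈ 𝓝 (0 : EuclideanSpace ℝ (Fin d)) := mem_interior_iff_mem_nhds.1 h0
  have hSconv : Convex ℝ (K ∩ -K) := hK.inter hK.neg
  have hDconv : Convex ℝ (K - K) := hK.sub hK
  have hDc : IsCompact (K - K) := by
    rw [sub_eq_add_neg]; exact hKc.add hKc.neg
  set U := interior (K ∩ -K) with hU
  have hUS : U ⊆ K ∩ -K := interior_subset
  have hUo : IsOpen U := isOpen_interior
  have hUg : ∀ u ∈ U, gauge K u < 1 ∧ gauge K (-u) < 1 := by
    intro u hu
    refine ⟨interior_subset_gauge_lt_one K (interior_mono inter_subset_left hu), ?_⟩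
    rw [← gauge_neg_set_eq_gauge_neg]
    exact interior_subset_gauge_lt_one (-K) (interior_mono inter_subset_right hu)
  have hgs : ∀ u ∈ U, ∀ w ∈ U, gauge K ((δ / 2) • u - (δ / 2) • w) < δ := by
    intro u hu w hw
    have h1 := gauge_add_le hK (absorbent_nhds_zero hKn) ((δ / 2) • u) ((δ / 2) • (-w))
    rw [gauge_smul_of_nonneg (by positivity), gauge_smul_of_nonneg (by positivity),
      smul_eq_mul, smul_eq_mul] at h1
    have h2 := (hUg u hu).1
    have h3 := (hUg w hw).2
    rw [sub_eq_add_neg, ← smul_neg]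
    nlinarith
  set T : ι → Set (EuclideanSpace ℝ (Fin d)) := fun i => x i +ᵥ (δ / 2) • U with hT
  have hTo : ∀ i, IsOpen (T i) := fun i => (hUo.smul₀ (by positivity)).vadd _
  set A : Set (EuclideanSpace ℝ (Fin d)) := ⋃ i ∈ s, T i with hA
  have hAo : IsOpen A := isOpen_biUnion fun i _ => hTo i
  have hdisj : (s : Set ι).PairwiseDisjoint T := by
    intro i hi j hj hij
    refine disjoint_left.2 ?_
    rintro _ ⟨_, ⟨u, hu, rfl⟩, rfl⟩ ⟨_, ⟨w, hw, rfl⟩, h⟩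
    simp only [vadd_eq_add] at h
    have e1 : x i - x j = (δ / 2) • w - (δ / 2) • u := by
      rw [sub_eq_sub_iff_add_eq_add, ← h]; abel
    have e2 : x j - x i = (δ / 2) • u - (δ / 2) • w := by rw [← neg_sub, e1, neg_sub]
    rcases hsep i hi j hj hij with h' | h'
    · rw [e1] at h'; exact (hgs w hw u hu).not_ge h'
    · rw [e2] at h'; exact (hgs u hu w hw).not_ge h'
  have hUvol : volume U = volume (K ∩ -K) := hSconv.measure_interior volume
  have hAvol : volume A = s.card * (ENNReal.ofReal ((δ / 2) ^ d) * volume (K ∩ -K)) := by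
    rw [hA, measure_biUnion_finset hdisj fun i _ => (hTo i).measurableSet]
    simp only [hT, measure_vadd]
    rw [Finset.sum_const, nsmul_eq_mul, Measure.addHaar_smul_of_nonneg _ (by positivity), hUvol]
    simp
  set ρ := (r + δ / 2) / 2 with hρ
  have hBM := volume_rpow_mul_rpow_le (a := 1 / 2) (b := 1 / 2) (by norm_num) (by norm_num)
    (by norm_num) (A := A) (B := -A) (C := ρ • (K - K)) hAo.measurableSet hAo.neg.measurableSet
    (hDc.smul ρ).measurableSet (by
      intro y hy z hz
      simp only [hA, mem_iUnion, Set.mem_neg] at hy hz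
      obtain ⟨i, hi, _, ⟨u, hu, rfl⟩, rfl⟩ := hy
      obtain ⟨j, hj, _, ⟨w, hw, rfl⟩, h⟩ := hz
      have hz' : z = -(x j +ᵥ (δ / 2) • w) := by
        simp only at h; rw [h, neg_neg]
      have h1 : x i - x j + (δ / 2) • (u - w) ∈ (r + δ / 2) • (K - K) := by
        rw [hDconv.add_smul hr (by positivity)]
        exact Set.add_mem_add (hdiff i hi j hj)
          (smul_mem_smul_set (Set.sub_mem_sub (hUS hu).1 (hUS hw).1))
      have h2 : (1 / 2 : ℝ) • (x i +ᵥ (δ / 2) • u) + (1 / 2 : ℝ) • z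
          = (1 / 2 : ℝ) • (x i - x j + (δ / 2) • (u - w)) := by
        rw [hz']; simp only [vadd_eq_add]; module
      have h3 : ρ • (K - K) = (1 / 2 : ℝ) • (r + δ / 2) • (K - K) := by
        rw [smul_smul, hρ]; congr 1; ring
      rw [h3]
      simp only at h2 ⊢
      rw [h2]
      exact smul_mem_smul_set h1)
  rw [Measure.measure_neg, ← ENNReal.rpow_add_of_nonneg _ _ (by norm_num) (by norm_num),
    show (1 / 2 : ℝ) + 1 / 2 = 1 by norm_num, ENNReal.rpow_one, hAvol,
    Measure.addHaar_smul_of_nonneg _ (by positivity), finrank_euclideanSpace_fin] at hBM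
  have hreal := ENNReal.toReal_mono (ENNReal.mul_ne_top (by simp) hDc.measure_lt_top.ne) hBM
  simp only [ENNReal.toReal_mul, ENNReal.toReal_natCast,
    ENNReal.toReal_ofReal (show 0 ≤ (δ / 2) ^ d by positivity),
    ENNReal.toReal_ofReal (show 0 ≤ ρ ^ d by positivity)] at hreal
  change _ * (_ * volume.real _) ≤ _ * volume.real _ at hreal
  have hρ' : ρ ^ d = (δ / 2) ^ d * (r / δ + 1 / 2) ^ d := by
    rw [← mul_pow, hρ]; congr 1; field_simp
  rw [hρ'] at hreal
  have hpos : 0 < (δ / 2) ^ d := by positivity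
  refine le_of_mul_le_mul_left ?_ hpos
  linarith

/-! ### Counting homothets by ratio -/

theorem Convex.smul_set_subset_of_le {E : Type*} [AddCommGroup E] [Module ℝ E] {K : Set E}
    (hK : Convex ℝ K) (h0 : (0 : E) ∈ K) {α β : ℝ} (hα : 0 ≤ α) (hαβ : α ≤ β) :
    α • K ⊆ β • K := by
  intro x hx
  rw [← add_sub_cancel α β, hK.add_smul hα (sub_nonneg.2 hαβ)]
  exact ⟨x, hx, 0, ⟨0, h0, smul_zero _⟩, add_zero _⟩

/-- Homothets whose ratios differ by at most the factor `β / α`: their reference points form a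
separated set of small diameter. -/
theorem card_mul_volume_le_of_ratio_mem_Icc {d : ℕ} {K : Set (EuclideanSpace ℝ (Fin d))}
    (hK : Convex ℝ K) (hKc : IsCompact K) (h0 : (0 : EuclideanSpace ℝ (Fin d)) ∈ interior K)
    {ι : Type*} (s : Finset ι) (v : ι → EuclideanSpace ℝ (Fin d)) (l : ι → ℝ) {α β : ℝ}
    (hα : 0 < α) (hl : ∀ i ∈ s, α ≤ l i ∧ l i ≤ β) (hβ : 0 ≤ β)
    (hsep : ∀ i ∈ s, ∀ j ∈ s, i ≠ j → l j ≤ gauge K (v i - v j))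
    (hint : ∀ i ∈ s, ∀ j ∈ s, i ≠ j → v i - v j ∈ l j • K - l i • K) :
    s.card * volume.real (K ∩ -K) ≤ (β / α + 1 / 2) ^ d * volume.real (K - K) := by
  have h0K : (0 : EuclideanSpace ℝ (Fin d)) ∈ K := interior_subset h0
  have hmono : ∀ i ∈ s, l i • K ⊆ β • K := fun i hi =>
    hK.smul_set_subset_of_le h0K (hα.le.trans (hl i hi).1) (hl i hi).2
  refine card_mul_volume_le_of_separated hK hKc h0 s v hβ hα (fun i hi j hj => ?_)
    fun i hi j hj hij => .inl ((hl j hj).1.trans (hsep i hi j hj hij))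
  by_cases hij : i = j
  · rw [hij, sub_self]
    exact ⟨0, ⟨0, h0K, 0, h0K, sub_self _⟩, smul_zero _⟩
  · obtain ⟨y, hy, z, hz, h⟩ := hint i hi j hj hij
    obtain ⟨y', hy', rfl⟩ := hmono j hj hy
    obtain ⟨z', hz', rfl⟩ := hmono i hi hz
    exact ⟨y' - z', Set.sub_mem_sub hy' hz', by rw [← h]; exact smul_sub _ _ _⟩

/-- Homothets that are much larger than a homothet `i₀` which they intersect: seen from the
reference point of `i₀` and rescaled to ratio `1`, their reference points
`w i = (l i)⁻¹ • (v i₀ - v i)` lie close to `K` and are separated, however different the ratios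
are. -/
theorem card_mul_volume_le_of_ratio_large {d : ℕ} (hd : 2 ≤ d)
    {K : Set (EuclideanSpace ℝ (Fin d))}
    (hK : Convex ℝ K) (hKc : IsCompact K) (h0 : (0 : EuclideanSpace ℝ (Fin d)) ∈ interior K)
    {θ : ℝ} (hθ1 : 0 ≤ θ) (hθ : -K ⊆ θ • K)
    {ι : Type*} (s : Finset ι) (v : ι → EuclideanSpace ℝ (Fin d)) (l : ι → ℝ) (i₀ : ι)
    (hi₀ : 0 < l i₀) (hpos : ∀ i ∈ s, 0 < l i) (hl : ∀ i ∈ s, θ * d * l i₀ ≤ l i)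
    (hsep : ∀ i ∈ s, ∀ j ∈ s, i ≠ j → l j ≤ gauge K (v i - v j))
    (hint : ∀ i ∈ s, v i₀ - v i ∈ l i • K - l i₀ • K) :
    s.card * volume.real (K ∩ -K) ≤
      ((1 + (d : ℝ)⁻¹) / (1 - (d : ℝ)⁻¹) + 1 / 2) ^ d * volume.real (K - K) := by
  have h0K : (0 : EuclideanSpace ℝ (Fin d)) ∈ K := interior_subset h0
  have habs : Absorbent ℝ K := absorbent_nhds_zero (mem_interior_iff_mem_nhds.1 h0)
  have hd0 : (0 : ℝ) < d := by exact_mod_cast (by lia : 0 < d)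
  have hd1 : (d : ℝ)⁻¹ < 1 := inv_lt_one_of_one_lt₀ (by exact_mod_cast (by lia : 1 < d))
  set w : ι → EuclideanSpace ℝ (Fin d) := fun i => (l i)⁻¹ • (v i₀ - v i) with hw
  have hlw : ∀ i ∈ s, l i • w i = v i₀ - v i := fun i hi => smul_inv_smul₀ (hpos i hi).ne' _
  -- the size of the homothet `i₀` is `ε i` after rescaling
  have hε : ∀ i ∈ s, l i₀ * θ / l i ≤ (d : ℝ)⁻¹ := by
    intro i hi
    have := hl i hi
    have := hpos i hi
    rw [div_le_iff₀ (hpos i hi), inv_mul_eq_div, le_div_iff₀ hd0]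
    linarith
  have hwK : ∀ i ∈ s, w i ∈ (1 + l i₀ * θ / l i) • K := by
    intro i hi
    have hli := hpos i hi
    have h1 : v i₀ - v i ∈ (l i + l i₀ * θ) • K := by
      obtain ⟨y, hy, _, ⟨z, hz, rfl⟩, h⟩ := hint i hi
      rw [hK.add_smul hli.le (by positivity), ← h]
      refine ⟨y, hy, -(l i₀ • z), ?_, (sub_eq_add_neg _ _).symm⟩
      rw [mul_smul, ← smul_neg]
      exact smul_mem_smul_set (hθ (Set.neg_mem_neg.2 hz))
    have h2 : (1 + l i₀ * θ / l i) = (l i)⁻¹ * (l i + l i₀ * θ) := by field_simp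
    rw [h2, mul_smul]
    exact smul_mem_smul_set h1
  have hwK' : ∀ i ∈ s, w i ∈ (1 + (d : ℝ)⁻¹) • K := by
    intro i hi
    have hli := hpos i hi
    refine hK.smul_set_subset_of_le h0K (by positivity) ?_ (hwK i hi)
    linarith [hε i hi]
  have key : ∀ i ∈ s, ∀ j ∈ s, i ≠ j → l i ≤ l j → 1 - (d : ℝ)⁻¹ ≤ gauge K (w j - w i) := by
    intro i hi j hj hij hle
    have hli := hpos i hi
    have hlj := hpos j hj
    have e : v i - v j = (l j - l i) • w j + l i • (w j - w i) := by
      have h1 := hlw i hi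
      have h2 := hlw j hj
      have : v i - v j = l j • w j - l i • w i := by rw [h1, h2]; abel
      rw [this]; module
    have h1 := hsep i hi j hj hij
    have h2 : gauge K (v i - v j) ≤ (l j - l i) * gauge K (w j) + l i * gauge K (w j - w i) := by
      rw [e]
      refine (gauge_add_le hK habs _ _).trans_eq ?_
      rw [gauge_smul_of_nonneg (sub_nonneg.2 hle), gauge_smul_of_nonneg hli.le, smul_eq_mul,
        smul_eq_mul]
    have h3 : gauge K (w j) ≤ 1 + l i₀ * θ / l j := gauge_le_of_mem (by positivity) (hwK j hj)
    have h4 : (l j - l i) * gauge K (w j) ≤ (l j - l i) * (1 + l i₀ * θ / l j) := by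
      gcongr
    have h5 : l i₀ * θ / l j * l j = l i₀ * θ := by field_simp
    have h6 : l i₀ * θ ≤ l i * (d : ℝ)⁻¹ := by
      have := hε i hi
      rwa [div_le_iff₀ hli, mul_comm (d : ℝ)⁻¹] at this
    have h7 : 0 ≤ l i * (l i₀ * θ / l j) := by positivity
    have h8 : l i * (1 - (d : ℝ)⁻¹) ≤ l i * gauge K (w j - w i) := by nlinarith
    exact le_of_mul_le_mul_left h8 hli
  refine card_mul_volume_le_of_separated hK hKc h0 s w (by positivity) (sub_pos.2 hd1)
    (fun i hi j hj => ?_) fun i hi j hj hij => ?_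
  · obtain ⟨y, hy, h⟩ := hwK' i hi
    obtain ⟨z, hz, h'⟩ := hwK' j hj
    exact ⟨y - z, Set.sub_mem_sub hy hz, by rw [← h, ← h']; exact smul_sub _ _ _⟩
  · rcases le_total (l i) (l j) with h | h
    · exact .inr (key i hi j hj hij h)
    · exact .inl (key j hj i hi hij.symm h)

/-- Since `(1 + 1 / d) / (1 - 1 / d) ≤ 1 + 4 / d`, this covers the packing bounds for both kinds of
classes of homothets. -/
theorem add_half_pow_le_exp {d : ℕ} (hd : 0 < d) {x : ℝ} (hx0 : 0 ≤ x)
    (hx : x ≤ 1 + 4 * (d : ℝ)⁻¹) :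
    (x + 1 / 2) ^ d ≤ (3 / 2 : ℝ) ^ d * Real.exp (8 / 3) := by
  have hd0 : (d : ℝ) ≠ 0 := by exact_mod_cast hd.ne'
  have h1 : x + 1 / 2 ≤ 3 / 2 * Real.exp (8 / 3 * (d : ℝ)⁻¹) := by
    have := Real.add_one_le_exp (8 / 3 * (d : ℝ)⁻¹)
    linarith
  calc (x + 1 / 2) ^ d ≤ (3 / 2 * Real.exp (8 / 3 * (d : ℝ)⁻¹)) ^ d := by gcongr
    _ = (3 / 2 : ℝ) ^ d * Real.exp (8 / 3) := by
      rw [mul_pow, ← Real.exp_nat_mul]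
      congr 2
      field_simp

/-- The main estimate, in the situation where the reference point is the origin: the homothets of
ratio less than `θ * d` times the smallest one are split into classes in which the ratios differ
by at most the factor `1 + 1 / d`, and the larger ones form one more class. -/
theorem card_mul_volume_le_of_arrangement {d : ℕ} (hd : 2 ≤ d)
    {K : Set (EuclideanSpace ℝ (Fin d))}
    (hK : Convex ℝ K) (hKc : IsCompact K) (h0 : (0 : EuclideanSpace ℝ (Fin d)) ∈ interior K)
    {θ : ℝ} (hθ1 : 1 ≤ θ) (hθ : -K ⊆ θ • K)
    {ι : Type*} (s : Finset ι) (v : ι → EuclideanSpace ℝ (Fin d)) (l : ι → ℝ)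
    (hpos : ∀ i, 0 < l i)
    (hsep : ∀ i j, i ≠ j → l j ≤ gauge K (v i - v j))
    (hint : ∀ i j, i ≠ j → v i - v j ∈ l j • K - l i • K) :
    s.card * volume.real (K ∩ -K) ≤
      4 * d * (Real.log d + Real.log θ) *
        ((3 / 2 : ℝ) ^ d * Real.exp (8 / 3) * volume.real (K - K)) := by
  classical
  have hd2 : (2 : ℝ) ≤ d := by exact_mod_cast hd
  have hd0 : (0 : ℝ) < d := by linarith
  have hdinv : (0 : ℝ) < (d : ℝ)⁻¹ := by positivity
  have hdinv2 : (d : ℝ)⁻¹ ≤ 1 / 2 := by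
    rw [one_div]; exact inv_anti₀ (by norm_num) hd2
  have hlogθ : 0 ≤ Real.log θ := Real.log_nonneg hθ1
  have hlogd : Real.log 2 ≤ Real.log d := Real.log_le_log (by norm_num) hd2
  have hlog2 := Real.log_two_gt_d9
  rcases s.eq_empty_or_nonempty with rfl | hs
  · simp only [Finset.card_empty, Nat.cast_zero, zero_mul]
    have : 0 ≤ Real.log d + Real.log θ := by linarith
    positivity
  obtain ⟨i₀, hi₀, hmin⟩ := s.exists_min_image l hs
  have hm := hpos i₀
  set q : ℝ := 1 + (d : ℝ)⁻¹ with hq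
  have hq1 : 1 < q := by linarith
  have hlogq : ((d : ℝ) + 1)⁻¹ ≤ Real.log q := by
    refine le_trans (le_of_eq ?_) (Real.one_sub_inv_le_log_of_pos (by linarith))
    rw [hq]
    field_simp
    ring
  set P : ℝ := (3 / 2 : ℝ) ^ d * Real.exp (8 / 3) * volume.real (K - K) with hP
  have hP0 : 0 ≤ P := by positivity
  have hex : ∀ i, ∃ n : ℕ, i ∈ s → q ^ n ≤ l i / l i₀ ∧ l i / l i₀ < q ^ (n + 1) := by
    intro i
    by_cases hi : i ∈ s
    · obtain ⟨n, hn⟩ := exists_nat_pow_near ((one_le_div hm).2 (hmin i hi)) hq1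
      exact ⟨n, fun _ => hn⟩
    · exact ⟨0, fun h => absurd h hi⟩
  choose k hk using hex
  set N := ⌊Real.log (θ * d) / Real.log q⌋₊ with hN
  set φ : ι → ℕ := fun i => if θ * d * l i₀ ≤ l i then N + 1 else k i with hφ
  have hkN : ∀ i ∈ s, ¬ θ * d * l i₀ ≤ l i → k i ≤ N := by
    intro i hi h
    refine Nat.le_floor ?_
    rw [le_div_iff₀ (by linarith [show 0 < ((d : ℝ) + 1)⁻¹ by positivity]), ← Real.log_pow]
    refine Real.log_le_log (by positivity) ((hk i hi).1.trans ?_)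
    rw [div_le_iff₀ hm]
    exact (not_le.1 h).le
  have hmaps : ∀ i ∈ s, φ i ∈ Finset.range (N + 2) := by
    intro i hi
    simp only [hφ, Finset.mem_range]
    split_ifs with h
    · lia
    · have := hkN i hi h; lia
  have hfib : ∀ n ∈ Finset.range (N + 2),
      ((s.filter fun i => φ i = n).card : ℝ) * volume.real (K ∩ -K) ≤ P := by
    intro n hn
    by_cases hnN : n = N + 1
    · have hlarge : ∀ i ∈ s.filter fun i => φ i = n, θ * d * l i₀ ≤ l i := by
        intro i hi
        obtain ⟨his, hi⟩ := Finset.mem_filter.1 hi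
        by_contra h
        simp only [hφ, if_neg h] at hi
        have := hkN i his h
        lia
      refine (card_mul_volume_le_of_ratio_large hd hK hKc h0 (by linarith) hθ _ v l i₀ hm
        (fun i _ => hpos i) hlarge (fun i _ j _ hij => hsep i j hij) fun i hi => ?_).trans ?_
      · refine hint i₀ i ?_
        rintro rfl
        have := hlarge i₀ hi
        nlinarith [mul_le_mul hθ1 hd2 (by norm_num) (by linarith)]
      · rw [hP]
        gcongr
        refine add_half_pow_le_exp (by lia) (div_nonneg (by linarith) (by linarith)) ?_
        rw [div_le_iff₀ (by linarith)]
        nlinarith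
    · have hband : ∀ i ∈ s.filter fun i => φ i = n,
          l i₀ * q ^ n ≤ l i ∧ l i ≤ l i₀ * q ^ (n + 1) := by
        intro i hi
        obtain ⟨his, hi⟩ := Finset.mem_filter.1 hi
        have hki : k i = n := by
          simp only [hφ] at hi
          split_ifs at hi with h
          · exact absurd hi.symm hnN
          · exact hi
        obtain ⟨h1, h2⟩ := hk i his
        rw [hki] at h1 h2
        rw [le_div_iff₀ hm] at h1
        rw [div_lt_iff₀ hm] at h2
        exact ⟨by linarith, by linarith⟩
      refine (card_mul_volume_le_of_ratio_mem_Icc hK hKc h0 _ v l (by positivity) hband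
        (by positivity) (fun i _ j _ hij => hsep i j hij) fun i _ j _ hij =>
          hint i j hij).trans ?_
      rw [hP]
      gcongr
      have : l i₀ * q ^ (n + 1) / (l i₀ * q ^ n) = q := by
        rw [pow_succ]; field_simp
      rw [this]
      exact add_half_pow_le_exp (by lia) (by linarith) (by linarith)
  have hNle : (N : ℝ) ≤ (d + 1) * (Real.log d + Real.log θ) := by
    have h1 : 0 ≤ Real.log (θ * d) := Real.log_nonneg (by nlinarith)
    have hpos' : 0 < ((d : ℝ) + 1)⁻¹ := by positivity
    calc (N : ℝ) ≤ Real.log (θ * d) / Real.log q :=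
          Nat.floor_le (div_nonneg h1 (hpos'.le.trans hlogq))
      _ ≤ Real.log (θ * d) / ((d : ℝ) + 1)⁻¹ := by gcongr
      _ = (d + 1) * (Real.log d + Real.log θ) := by
        rw [Real.log_mul (by linarith) hd0.ne', div_inv_eq_mul]; ring
  calc (s.card : ℝ) * volume.real (K ∩ -K)
      = ∑ n ∈ Finset.range (N + 2),
          ((s.filter fun i => φ i = n).card : ℝ) * volume.real (K ∩ -K) := by
        rw [Finset.card_eq_sum_card_fiberwise hmaps, Nat.cast_sum, Finset.sum_mul]
    _ ≤ ∑ n ∈ Finset.range (N + 2), P := Finset.sum_le_sum hfib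
    _ = (N + 2 : ℝ) * P := by simp
    _ ≤ 4 * d * (Real.log d + Real.log θ) * P := by
        gcongr
        nlinarith

/-! ### Finiteness of `kappa` and the bound in terms of the asymmetry -/

theorem kappaStrict_le_kappa {E : Type*} [NormedAddCommGroup E] [NormedSpace ℝ E]
    (K : Set E) (p : E) : kappaStrict K p ≤ kappa K p := by
  refine sSup_le_sSup ?_
  rintro N ⟨ι, v, l, hv, hint, hN⟩
  refine ⟨ι, v, l, ⟨hv.pos, fun i j hij h => hv.notMem i j hij ?_⟩, hint, hN⟩
  exact vadd_set_mono (smul_set_mono interior_subset) h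

theorem ENat.card_le_of_forall_finset_card_le {ι : Type*} {m : ℕ}
    (h : ∀ s : Finset ι, s.card ≤ m) : ENat.card ι ≤ m := by
  rcases finite_or_infinite ι with hι | hι
  · have := Fintype.ofFinite ι
    rw [ENat.card_eq_coe_fintype_card]
    exact_mod_cast h Finset.univ
  · obtain ⟨s, hs⟩ := Infinite.exists_subset_card_eq ι (m + 1)
    have := h s
    lia

theorem sub_singleton_eq_neg_vadd {E : Type*} [AddCommGroup E] (K : Set E) (p : E) :
    K - {p} = -p +ᵥ K := by
  rw [Set.sub_singleton]
  exact image_congr fun x _ => by simp [sub_eq_neg_add]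

/-- The homothets `v i + l i • K` are homothets of `K - {p}`, whose reference point is the origin,
with the translation vectors `v i + l i • p`. -/
theorem IsMinkowskiArrangement.le_gauge {E : Type*} [NormedAddCommGroup E] [NormedSpace ℝ E]
    {K : Set E} {p : E} {ι : Type*} {v : ι → E} {l : ι → ℝ} (h : IsMinkowskiArrangement K p v l)
    (hK : Convex ℝ (K - {p})) (h0 : (0 : E) ∈ interior (K - {p})) {i j : ι} (hij : i ≠ j) :
    l j ≤ gauge (K - {p}) ((v i + l i • p) - (v j + l j • p)) := by
  by_contra! hlt
  have hlj := h.pos j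
  have h1 : gauge (K - {p}) ((l j)⁻¹ • ((v i + l i • p) - (v j + l j • p))) < 1 := by
    rw [gauge_smul_of_nonneg (by positivity), smul_eq_mul, inv_mul_lt_iff₀ hlj, mul_one]
    exact hlt
  rw [gauge_lt_one_iff_mem_interior hK (mem_interior_iff_mem_nhds.1 h0),
    sub_singleton_eq_neg_vadd, interior_vadd] at h1
  obtain ⟨u, hu, hu'⟩ := h1
  refine h.notMem i j hij ⟨l j • u, smul_mem_smul_set hu, ?_⟩
  have hu2 : u = p + (l j)⁻¹ • ((v i + l i • p) - (v j + l j • p)) := by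
    rw [← hu']; simp
  simp only [vadd_eq_add]
  rw [hu2, smul_add, smul_inv_smul₀ hlj.ne']
  abel

theorem PairwiseIntersecting.sub_mem {E : Type*} [NormedAddCommGroup E] [NormedSpace ℝ E]
    {K : Set E} (p : E) {ι : Type*} {v : ι → E} {l : ι → ℝ} (h : PairwiseIntersecting K v l)
    {i j : ι} (hij : i ≠ j) :
    (v i + l i • p) - (v j + l j • p) ∈ l j • (K - {p}) - l i • (K - {p}) := by
  obtain ⟨_, ⟨_, ⟨y, hy, rfl⟩, rfl⟩, ⟨_, ⟨z, hz, rfl⟩, h⟩⟩ := h i j hij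
  simp only [vadd_eq_add] at h
  refine ⟨l j • (z - p), smul_mem_smul_set ⟨z, hz, p, rfl, rfl⟩, l i • (y - p),
    smul_mem_smul_set ⟨y, hy, p, rfl, rfl⟩, ?_⟩
  have h' : v i - v j = l j • z - l i • y := by
    rw [sub_eq_sub_iff_add_eq_add, ← h]; abel
  have : v i + l i • p - (v j + l j • p) = (v i - v j) + (l i • p - l j • p) := by abel
  simp only
  rw [this, h']
  module

section Translate

variable {d : ℕ} {K : Set (EuclideanSpace ℝ (Fin d))} {p : EuclideanSpace ℝ (Fin d)}

theorem zero_mem_interior_sub_singleton (hp : p ∈ interior K) :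
    (0 : EuclideanSpace ℝ (Fin d)) ∈ interior (K - {p}) := by
  rw [sub_singleton_eq_neg_vadd, interior_vadd]
  exact ⟨p, hp, by simp⟩

theorem volume_real_inter_neg_pos {K : Set (EuclideanSpace ℝ (Fin d))} (hKc : IsCompact K)
    (h0 : (0 : EuclideanSpace ℝ (Fin d)) ∈ interior K) : 0 < volume.real (K ∩ -K) := by
  have hn : K ∈ 𝓝 (0 : EuclideanSpace ℝ (Fin d)) := mem_interior_iff_mem_nhds.1 h0
  have hn' : -K ∈ 𝓝 (0 : EuclideanSpace ℝ (Fin d)) := by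
    have := neg_mem_nhds_zero _ hn
    exact this
  exact ENNReal.toReal_pos (Measure.measure_pos_of_mem_nhds _ (inter_mem hn hn')).ne'
    ((measure_mono inter_subset_left).trans_lt hKc.measure_lt_top).ne

theorem neg_sub_singleton (K : Set (EuclideanSpace ℝ (Fin d))) (p : EuclideanSpace ℝ (Fin d)) :
    -(K - {p}) = {p} - K := neg_sub _ _

/-- The number of homothets is bounded in terms of any `θ ≥ 1` with
`p - K ⊆ θ • (K - p)`. -/
theorem exists_kappa_eq_of_neg_subset (hd : 2 ≤ d) (hK : Convex ℝ K) (hKc : IsCompact K)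
    (hp : p ∈ interior K) {θ : ℝ} (hθ1 : 1 ≤ θ) (hθ : {p} - K ⊆ θ • (K - {p})) :
    ∃ n : ℕ, kappa K p = n ∧
      (n : ℝ) ≤ 4 * d * (Real.log d + Real.log θ) *
        ((3 / 2 : ℝ) ^ d * Real.exp (8 / 3) * volume.real (K - K)) /
          volume.real ((K - {p}) ∩ ({p} - K)) := by
  have hK0 : Convex ℝ (K - {p}) := hK.sub (convex_singleton p)
  have hKc0 : IsCompact (K - {p}) := by
    rw [sub_singleton_eq_neg_vadd]; exact hKc.vadd _
  have h0 := zero_mem_interior_sub_singleton hp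
  have hdiff : K - {p} - (K - {p}) = K - K := by
    rw [sub_sub_sub_comm, Set.singleton_sub_singleton, sub_self, Set.singleton_zero, sub_zero]
  set B : ℝ := 4 * d * (Real.log d + Real.log θ) *
    ((3 / 2 : ℝ) ^ d * Real.exp (8 / 3) * volume.real (K - K)) /
      volume.real ((K - {p}) ∩ ({p} - K)) with hB
  have hbound : ∀ (ι : Type) (v : ι → EuclideanSpace ℝ (Fin d)) (l : ι → ℝ),
      IsMinkowskiArrangement K p v l → PairwiseIntersecting K v l → ∀ s : Finset ι,
      (s.card : ℝ) ≤ B := by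
    intro ι v l hv hint s
    have := card_mul_volume_le_of_arrangement hd hK0 hKc0 h0 hθ1
      (by rwa [neg_sub_singleton]) s (fun i => v i + l i • p) l hv.pos
      (fun i j hij => hv.le_gauge hK0 h0 hij) fun i j hij => hint.sub_mem p hij
    rw [neg_sub_singleton, hdiff] at this
    rw [hB, le_div_iff₀ (by rw [← neg_sub_singleton]; exact volume_real_inter_neg_pos hKc0 h0)]
    exact this
  have hB0 : 0 ≤ B := by
    have h1 := Real.log_nonneg hθ1
    have h2 : 0 ≤ Real.log d := Real.log_natCast_nonneg d
    positivity
  have hle : kappa K p ≤ (⌊B⌋₊ : ℕ) := by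
    refine sSup_le ?_
    rintro N ⟨ι, v, l, hv, hint, rfl⟩
    exact ENat.card_le_of_forall_finset_card_le fun s => Nat.le_floor (hbound ι v l hv hint s)
  obtain ⟨n, hn⟩ := ENat.ne_top_iff_exists.1 (ne_top_of_le_ne_top (ENat.natCast_ne_top _) hle)
  refine ⟨n, hn.symm, ?_⟩
  rw [← hn] at hle
  exact (Nat.le_floor_iff hB0).1 (by exact_mod_cast hle)

theorem one_le_of_neg_subset_smul (hd : 0 < d) (hKc : IsCompact K) (hp : p ∈ interior K) {t : ℝ}
    (ht0 : 0 ≤ t) (ht : {p} - K ⊆ t • (K - {p})) : 1 ≤ t := by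
  have hKc0 : IsCompact (K - {p}) := by
    rw [sub_singleton_eq_neg_vadd]; exact hKc.vadd _
  have h0 := zero_mem_interior_sub_singleton hp
  have hV : 0 < volume.real (K - {p}) :=
    ENNReal.toReal_pos (Measure.measure_pos_of_mem_nhds _ (mem_interior_iff_mem_nhds.1 h0)).ne'
      hKc0.measure_lt_top.ne
  rw [← neg_sub_singleton] at ht
  have h1 := ENNReal.toReal_mono (hKc0.smul t).measure_lt_top.ne (measure_mono (μ := volume) ht)
  rw [Measure.measure_neg, Measure.addHaar_smul_of_nonneg _ ht0, finrank_euclideanSpace_fin,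
    ENNReal.toReal_mul, ENNReal.toReal_ofReal (by positivity)] at h1
  change volume.real _ ≤ _ * volume.real _ at h1
  by_contra! hlt
  have := pow_lt_one₀ ht0 hlt hd.ne'
  nlinarith

theorem nonempty_setOf_neg_subset_smul (hKc : IsCompact K) (hp : p ∈ interior K) :
    {t : ℝ | 0 ≤ t ∧ {p} - K ⊆ t • (K - {p})}.Nonempty := by
  have hKc0 : IsCompact (K - {p}) := by
    rw [sub_singleton_eq_neg_vadd]; exact hKc.vadd _
  have h0 := mem_interior_iff_mem_nhds.1 (zero_mem_interior_sub_singleton hp)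
  have hb := NormedSpace.isVonNBounded_of_isBounded ℝ hKc0.neg.isBounded
  obtain ⟨r, hr, h⟩ := (hb h0).exists_pos
  refine ⟨r, hr.le, ?_⟩
  rw [← neg_sub_singleton]
  exact h r (by rw [Real.norm_of_nonneg hr.le])

theorem one_le_asymmetry (hd : 0 < d) (hKc : IsCompact K) (hp : p ∈ interior K) :
    1 ≤ asymmetry K p :=
  le_csInf (nonempty_setOf_neg_subset_smul hKc hp) fun _ ht =>
    one_le_of_neg_subset_smul hd hKc hp ht.1 ht.2

theorem exists_kappa_eq_of_asymmetry (hd : 2 ≤ d) (hK : Convex ℝ K) (hKc : IsCompact K)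
    (hp : p ∈ interior K) :
    ∃ n : ℕ, kappa K p = n ∧
      (n : ℝ) ≤ (3 / 2 : ℝ) ^ d *
        (volume.real (K - K) / volume.real ((K - {p}) ∩ ({p} - K))) *
        (8 * Real.exp (8 / 3) * (d * (Real.log d + Real.log (asymmetry K p)))) := by
  have h1 := one_le_asymmetry (by lia) hKc hp
  -- any admissible `θ` within a factor `2` of the infimum will do
  obtain ⟨θ, ⟨hθ0, hθ⟩, hlt⟩ := exists_lt_of_csInf_lt (nonempty_setOf_neg_subset_smul hKc hp)
    (show asymmetry K p < 2 * asymmetry K p by linarith)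
  have hθ1 := one_le_of_neg_subset_smul (by lia) hKc hp hθ0 hθ
  obtain ⟨n, hn, hle⟩ := exists_kappa_eq_of_neg_subset hd hK hKc hp hθ1 hθ
  refine ⟨n, hn, hle.trans ?_⟩
  have hlog : Real.log θ ≤ Real.log 2 + Real.log (asymmetry K p) := by
    rw [← Real.log_mul (by norm_num) (by linarith)]
    exact Real.log_le_log (by linarith) hlt.le
  have hd2 : (2 : ℝ) ≤ d := by exact_mod_cast hd
  have hlogd : Real.log 2 ≤ Real.log d := Real.log_le_log (by norm_num) hd2
  have hla := Real.log_nonneg h1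
  rw [mul_div_assoc, mul_div_assoc]
  set ρ := volume.real (K - K) / volume.real ((K - {p}) ∩ ({p} - K)) with hρ
  have hρ0 : 0 ≤ ρ := by positivity
  calc 4 * d * (Real.log d + Real.log θ) * ((3 / 2 : ℝ) ^ d * Real.exp (8 / 3) * ρ)
      ≤ 4 * d * (2 * (Real.log d + Real.log (asymmetry K p))) *
          ((3 / 2 : ℝ) ^ d * Real.exp (8 / 3) * ρ) := by
        gcongr
        linarith
    _ = _ := by ring

end Translate

/-! ### The overlap function -/

/-- The convolution of the indicator functions of `A` and `B`. -/
noncomputable def overlapVolume {d : ℕ} (A B : Set (EuclideanSpace ℝ (Fin d)))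
    (x : EuclideanSpace ℝ (Fin d)) : ℝ≥0∞ :=
  volume {y | y ∈ A ∧ x - y ∈ B}

section Overlap

variable {d : ℕ} {A B : Set (EuclideanSpace ℝ (Fin d))}

theorem measurableSet_overlap (hA : MeasurableSet A) (hB : MeasurableSet B) :
    MeasurableSet {p : EuclideanSpace ℝ (Fin d) × EuclideanSpace ℝ (Fin d) |
      p.2 ∈ A ∧ p.1 - p.2 ∈ B} :=
  (measurable_snd hA).inter ((measurable_fst.sub measurable_snd) hB)

theorem measurable_overlapVolume (hA : MeasurableSet A) (hB : MeasurableSet B) :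
    Measurable (overlapVolume A B) :=
  measurable_measure_prodMk_left (measurableSet_overlap hA hB)

theorem overlapVolume_lt_top (hA : volume A ≠ ∞) (x : EuclideanSpace ℝ (Fin d)) :
    overlapVolume A B x < ∞ :=
  (measure_mono fun _ hy => hy.1).trans_lt hA.lt_top

theorem lintegral_mul_overlapVolume (hA : MeasurableSet A) (hB : MeasurableSet B)
    {Φ : EuclideanSpace ℝ (Fin d) → ℝ≥0∞} (hΦ : Measurable Φ) :
    ∫⁻ x, Φ x * overlapVolume A B x = ∫⁻ y in A, ∫⁻ z in B, Φ (y + z) := by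
  have hS := measurableSet_overlap hA hB
  have h1 : ∀ x, Φ x * overlapVolume A B x =
      ∫⁻ y, A.indicator 1 y * (Φ x * B.indicator 1 (x - y)) := by
    intro x
    have hm : MeasurableSet {y | y ∈ A ∧ x - y ∈ B} := measurable_prodMk_left hS
    rw [overlapVolume, ← lintegral_indicator_one hm, ← lintegral_const_mul _
      (measurable_one.indicator hm)]
    refine lintegral_congr fun y => ?_
    by_cases hy : y ∈ A <;> by_cases hxy : x - y ∈ B <;> simp [hy, hxy]
  simp_rw [h1]
  have hB1 : Measurable (B.indicator (1 : EuclideanSpace ℝ (Fin d) → ℝ≥0∞)) :=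
    measurable_one.indicator hB
  have hA1 : Measurable (A.indicator (1 : EuclideanSpace ℝ (Fin d) → ℝ≥0∞)) :=
    measurable_one.indicator hA
  rw [lintegral_lintegral_swap (by fun_prop), ← lintegral_indicator hA]
  refine lintegral_congr fun y => ?_
  rw [lintegral_const_mul _ (by fun_prop)]
  by_cases hy : y ∈ A
  · rw [indicator_of_mem hy, indicator_of_mem hy, Pi.one_apply, one_mul,
      ← lintegral_add_left_eq_self _ y, ← lintegral_indicator hB]
    refine lintegral_congr fun z => ?_
    by_cases hz : z ∈ B <;> simp [hz]
  · simp [hy]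

theorem lintegral_overlapVolume (hA : MeasurableSet A) (hB : MeasurableSet B) :
    ∫⁻ x, overlapVolume A B x = volume A * volume B := by
  have := lintegral_mul_overlapVolume hA hB (Φ := fun _ => 1) measurable_const
  simpa [mul_comm] using this

end Overlap

/-! ### The Rogers–Shephard inequality -/

theorem integral_pow_mul_one_sub_pow (m n : ℕ) :
    ∫ t in (0 : ℝ)..1, t ^ m * (1 - t) ^ n = m.factorial * n.factorial / (m + n + 1).factorial := by
  induction n generalizing m with
  | zero =>
    simp [integral_pow, Nat.factorial_succ]
    field_simp
  | succ n ih =>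
    -- integration by parts lowers the exponent of `1 - t`
    have hd : ∀ t ∈ uIcc (0 : ℝ) 1, HasDerivAt (fun t : ℝ => t ^ (m + 1) * (1 - t) ^ (n + 1))
        ((m + 1) * (t ^ m * (1 - t) ^ (n + 1)) - (n + 1) * (t ^ (m + 1) * (1 - t) ^ n)) t := by
      intro t _
      have h1 := (hasDerivAt_id t).pow (m + 1)
      have h2 := ((hasDerivAt_id t).const_sub 1).pow (n + 1)
      refine (h1.mul h2).congr_deriv ?_
      simp only [Pi.pow_apply, id, Nat.add_sub_cancel]
      push_cast
      ring
    have h := intervalIntegral.integral_eq_sub_of_hasDerivAt hd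
      (Continuous.intervalIntegrable (by fun_prop) _ _)
    rw [intervalIntegral.integral_sub (Continuous.intervalIntegrable (by fun_prop) _ _)
      (Continuous.intervalIntegrable (by fun_prop) _ _), intervalIntegral.integral_const_mul,
      intervalIntegral.integral_const_mul, ih] at h
    have h0 : (m + 1 : ℝ) * ∫ t in (0 : ℝ)..1, t ^ m * (1 - t) ^ (n + 1) =
        (n + 1) * ((m + 1).factorial * n.factorial / (m + 1 + n + 1).factorial) := by
      simp at h
      linarith
    have hm : (m + 1 : ℝ) ≠ 0 := by positivity
    rw [← mul_right_inj' hm, h0, show m + 1 + n + 1 = m + (n + 1) + 1 by ring,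
      Nat.factorial_succ m, Nat.factorial_succ n]
    push_cast
    ring

theorem integral_mul_pow_mul_one_sub_pow_self {d : ℕ} (hd : 0 < d) :
    ∫ t in (0 : ℝ)..1, (1 - t) ^ d * (d * t ^ (d - 1)) = (((2 * d).choose d : ℕ) : ℝ)⁻¹ := by
  have h : ∀ t : ℝ, (1 - t) ^ d * (d * t ^ (d - 1)) = d * (t ^ (d - 1) * (1 - t) ^ d) :=
    fun t => by ring
  simp_rw [h]
  rw [intervalIntegral.integral_const_mul, integral_pow_mul_one_sub_pow,
    show d - 1 + d + 1 = 2 * d by lia, Nat.choose_eq_factorial_div_factorial (by lia),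
    Nat.cast_div (Nat.factorial_mul_factorial_dvd_factorial (by lia)) (by positivity),
    show 2 * d - d = d by lia, inv_div, ← mul_div_assoc, ← mul_assoc,
    show (d : ℝ) * ((d - 1).factorial : ℝ) = (d.factorial : ℝ) by
      exact_mod_cast Nat.mul_factorial_pred hd.ne']
  push_cast
  rfl

/-- If `x = t • (y - z)` with `y, z ∈ K`, then `K ∩ (x + K)` contains a translate of
`(1 - t) • K`. -/
theorem le_overlapVolume_neg {d : ℕ} {K : Set (EuclideanSpace ℝ (Fin d))} (hK : Convex ℝ K)
    {t : ℝ} (ht0 : 0 ≤ t) (ht1 : t ≤ 1) {x : EuclideanSpace ℝ (Fin d)}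
    (hx : x ∈ t • (K - K)) :
    ENNReal.ofReal ((1 - t) ^ d) * volume K ≤ overlapVolume K (-K) x := by
  obtain ⟨_, ⟨y, hy, z, hz, rfl⟩, rfl⟩ := hx
  have h1 : ENNReal.ofReal ((1 - t) ^ d) * volume K = volume (t • y +ᵥ (1 - t) • K) := by
    rw [measure_vadd, Measure.addHaar_smul_of_nonneg _ (by linarith),
      finrank_euclideanSpace_fin]
  rw [h1]
  refine measure_mono ?_
  rintro _ ⟨_, ⟨k, hk, rfl⟩, rfl⟩
  simp only [vadd_eq_add, mem_ofPred_eq, Set.mem_neg]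
  refine ⟨hK hy hk ht0 (by linarith) (by ring), ?_⟩
  convert hK hz hk ht0 (sub_nonneg.2 ht1) (by ring) using 1
  module

/-- The Rogers–Shephard inequality. -/
theorem volume_real_sub_self_le {d : ℕ} (hd : 0 < d) {K : Set (EuclideanSpace ℝ (Fin d))}
    (hK : Convex ℝ K) (hKc : IsCompact K) (hKi : (interior K).Nonempty) :
    volume.real (K - K) ≤ ((2 * d).choose d : ℕ) * volume.real K := by
  have hKf : volume K ≠ ∞ := hKc.measure_lt_top.ne
  have hKm := hKc.measurableSet
  have hDc : IsCompact (K - K) := by rw [sub_eq_add_neg]; exact hKc.add hKc.neg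
  have hV : 0 < volume.real K := ENNReal.toReal_pos
    ((isOpen_interior.measure_pos volume hKi).trans_le (measure_mono interior_subset)).ne' hKf
  have hV' : volume K ≠ 0 := fun h => hV.ne' (by simp [Measure.real, h])
  have hd0 : (d : ℝ) ≠ 0 := by exact_mod_cast hd.ne'
  set g := overlapVolume K (-K) with hg
  have hgm : Measurable g := measurable_overlapVolume hKm hKm.neg
  have hgf : ∀ x, g x ≠ ∞ := fun x => (overlapVolume_lt_top hKf x).ne
  -- the `d`-th power of `f` is the normalised overlap
  set f : EuclideanSpace ℝ (Fin d) → ℝ := fun x => ((g x / volume K).toReal) ^ ((d : ℝ)⁻¹) with hf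
  have hfm : Measurable f := (hgm.div_const _).ennreal_toReal.pow_const _
  have hf0 : ∀ x, 0 ≤ f x := fun x => Real.rpow_nonneg ENNReal.toReal_nonneg _
  have hfd : ∀ x, ENNReal.ofReal (f x ^ d) = g x / volume K := by
    intro x
    rw [hf, Real.rpow_inv_natCast_pow ENNReal.toReal_nonneg hd.ne', ENNReal.ofReal_toReal]
    exact ENNReal.div_ne_top (hgf x) hV'
  have hlayer := lintegral_comp_eq_lintegral_meas_le_mul (volume) (f := f)
    (g := fun t : ℝ => d * t ^ (d - 1)) (ae_of_all _ hf0) hfm.aemeasurable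
    (fun t _ => Continuous.intervalIntegrable (by fun_prop) _ _)
    (by
      filter_upwards [self_mem_ae_restrict measurableSet_Ioi] with t ht
      have : (0 : ℝ) < t := ht
      positivity)
  have hint : ∀ x, ∫ t in (0 : ℝ)..f x, (d : ℝ) * t ^ (d - 1) = f x ^ d := by
    intro x
    rw [intervalIntegral.integral_const_mul, integral_pow, Nat.sub_add_cancel hd,
      zero_pow hd.ne', sub_zero, Nat.cast_sub hd, Nat.cast_one, sub_add_cancel,
      mul_div_cancel₀ _ hd0]
  simp_rw [hint, hfd] at hlayer
  have hleft : ∫⁻ x, g x / volume K = volume K := by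
    simp_rw [div_eq_mul_inv]
    rw [lintegral_mul_const _ hgm, hg, lintegral_overlapVolume hKm hKm.neg, Measure.measure_neg,
      mul_assoc, ENNReal.mul_inv_cancel hV' hKf, mul_one]
  rw [hleft] at hlayer
  have hlevel : ∀ t ∈ Ioc (0 : ℝ) 1,
      ENNReal.ofReal ((1 - t) ^ d) * volume (K - K) ≤ volume {x | t ≤ f x} := by
    intro t ht
    have h1 : ENNReal.ofReal ((1 - t) ^ d) * volume (K - K) = volume ((1 - t) • (K - K)) := by
      rw [Measure.addHaar_smul_of_nonneg _ (by linarith [ht.2]), finrank_euclideanSpace_fin]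
    rw [h1]
    refine measure_mono fun x hx => ?_
    have h2 := le_overlapVolume_neg hK (by linarith [ht.2]) (by linarith [ht.1]) hx
    rw [sub_sub_cancel, ← ENNReal.le_div_iff_mul_le (.inl hV') (.inl hKf), ← hg, ← hfd] at h2
    have h3 := (ENNReal.ofReal_le_ofReal_iff (pow_nonneg (hf0 x) d)).1 h2
    exact (pow_le_pow_iff_left₀ ht.1.le (hf0 x) hd.ne').1 h3
  have hlow : volume (K - K) * ENNReal.ofReal ((((2 * d).choose d : ℕ) : ℝ)⁻¹) ≤ volume K := by
    calc volume (K - K) * ENNReal.ofReal ((((2 * d).choose d : ℕ) : ℝ)⁻¹)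
        = volume (K - K) *
            ∫⁻ t in Ioc (0 : ℝ) 1, ENNReal.ofReal ((1 - t) ^ d * (d * t ^ (d - 1))) := by
          rw [← integral_mul_pow_mul_one_sub_pow_self hd,
            intervalIntegral.integral_of_le zero_le_one, ofReal_integral_eq_lintegral_ofReal]
          · exact (Continuous.integrableOn_Icc (by fun_prop)).mono_set Ioc_subset_Icc_self
          · filter_upwards [self_mem_ae_restrict measurableSet_Ioc] with t ht
            have h1 : 0 ≤ 1 - t := by linarith [ht.2]
            have h2 : 0 ≤ t := ht.1.le
            positivity
      _ = ∫⁻ t in Ioc (0 : ℝ) 1,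
            volume (K - K) * ENNReal.ofReal ((1 - t) ^ d * (d * t ^ (d - 1))) :=
          (lintegral_const_mul' _ _ hDc.measure_lt_top.ne).symm
      _ ≤ ∫⁻ t in Ioc (0 : ℝ) 1, volume {x | t ≤ f x} * ENNReal.ofReal (d * t ^ (d - 1)) := by
          refine setLIntegral_mono' measurableSet_Ioc fun t ht => ?_
          rw [ENNReal.ofReal_mul (pow_nonneg (by linarith [ht.2]) _), ← mul_assoc,
            mul_comm (volume (K - K))]
          gcongr
          exact hlevel t ht
      _ ≤ ∫⁻ t in Ioi (0 : ℝ), volume {x | t ≤ f x} * ENNReal.ofReal (d * t ^ (d - 1)) :=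
          lintegral_mono_set Ioc_subset_Ioi_self
      _ = volume K := hlayer.symm
  have hreal := ENNReal.toReal_mono hKf hlow
  rw [ENNReal.toReal_mul, ENNReal.toReal_ofReal (by positivity)] at hreal
  change volume.real _ * _ ≤ volume.real _ at hreal
  have hch : (0 : ℝ) < ((2 * d).choose d : ℕ) := by
    exact_mod_cast Nat.choose_pos (by lia)
  rwa [mul_inv_le_iff₀ hch, mul_comm] at hreal

/-! ### The Milman–Pajor inequality -/

/-- A concave function on an open convex set has a supergradient at every point. -/
theorem ConcaveOn.exists_le_add_continuousLinearMap {E : Type*} [NormedAddCommGroup E]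
    [NormedSpace ℝ E] [FiniteDimensional ℝ E] {U : Set E} {F : E → ℝ} (hF : ConcaveOn ℝ U F)
    (hU : IsOpen U) {x₀ : E} (hx₀ : x₀ ∈ U) :
    ∃ u : E →L[ℝ] ℝ, ∀ x ∈ U, F x ≤ F x₀ + u (x - x₀) := by
  set H : Set (E × ℝ) := {p | p.1 ∈ U ∧ p.2 < F p.1} with hH
  have hHo : IsOpen H := by
    have hc : ContinuousOn (fun p : E × ℝ => F p.1 - p.2) (U ×ˢ univ) :=
      ((hF.continuousOn hU).comp continuousOn_fst fun p hp => hp.1).sub continuousOn_snd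
    have := hc.isOpen_inter_preimage (hU.prod isOpen_univ) isOpen_Ioi (t := Ioi 0)
    convert this using 1
    ext p
    simp [hH]
  obtain ⟨φ, hφ⟩ := geometric_hahn_banach_open_point hF.convex_strict_hypograph hHo
    (x := (x₀, F x₀)) fun h => lt_irrefl _ h.2
  set c := φ (0, 1) with hc
  set a : E →L[ℝ] ℝ := φ.comp (ContinuousLinearMap.inl ℝ E ℝ) with ha
  have hsplit : ∀ x r, φ (x, r) = a x + r * c := by
    intro x r
    have : (x, r) = (x, (0 : ℝ)) + r • ((0 : E), (1 : ℝ)) := by simp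
    rw [this, map_add, map_smul, smul_eq_mul, ha, hc]
    rfl
  have hcpos : 0 < c := by
    have := hφ (x₀, F x₀ - 1) ⟨hx₀, by simp⟩
    rw [hsplit, hsplit] at this
    linarith
  refine ⟨-c⁻¹ • a, fun x hx => ?_⟩
  have h1 : a x + F x * c ≤ a x₀ + F x₀ * c := by
    refine le_of_forall_pos_lt_add fun ε hε => ?_
    have := hφ (x, F x - ε / c) ⟨hx, by simp only; linarith [div_pos hε hcpos]⟩
    rw [hsplit, hsplit, sub_mul, div_mul_cancel₀ _ hcpos.ne'] at this
    linarith
  simp only [_root_.smul_apply, map_sub, smul_eq_mul]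
  have h2 : F x ≤ (a x₀ + F x₀ * c - a x) / c := by
    rw [le_div_iff₀ hcpos]; linarith
  refine h2.trans_eq ?_
  field_simp
  ring

theorem setIntegrable_of_continuous_of_isBounded {d : ℕ} {G : Set (EuclideanSpace ℝ (Fin d))}
    (hG : Bornology.IsBounded G) {f : EuclideanSpace ℝ (Fin d) → ℝ} (hf : Continuous f) :
    IntegrableOn f G :=
  (hf.continuousOn.integrableOn_compact hG.isCompact_closure).mono_set subset_closure

/-- The Milman–Pajor inequality. The overlap function `g x = vol (G ∩ (x - G))` is log-concave by
the Brunn–Minkowski inequality, hence `g x ≤ g 0 * exp (u x)` on `G + G` for some linear form `u`.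
Integrating `exp (-u x) * g x` over `G + G` gives `(∫_G exp (-u)) ^ 2 ≤ g 0 * 2 ^ d * vol G`, and
`∫_G exp (-u) ≥ ∫_G (1 - u) = vol G` since the centroid is the origin. -/
theorem volume_real_le_two_pow_mul_inter_neg {d : ℕ} {G : Set (EuclideanSpace ℝ (Fin d))}
    (hG : Convex ℝ G) (hGo : IsOpen G) (hGb : Bornology.IsBounded G)
    (h0 : (0 : EuclideanSpace ℝ (Fin d)) ∈ G)
    (hcent : ∀ u : EuclideanSpace ℝ (Fin d) →L[ℝ] ℝ, ∫ x in G, u x = 0) :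
    volume.real G ≤ 2 ^ d * volume.real (G ∩ -G) := by
  have hGf : volume G ≠ ∞ := hGb.measure_lt_top.ne
  have hGpos : volume G ≠ 0 := (hGo.measure_pos volume ⟨0, h0⟩).ne'
  have hGm := hGo.measurableSet
  set g := overlapVolume G G with hg
  have hgf : ∀ x, g x ≠ ∞ := fun x => (overlapVolume_lt_top hGf x).ne
  have hSo : ∀ x, IsOpen {y | y ∈ G ∧ x - y ∈ G} := fun x =>
    hGo.inter (hGo.preimage (by fun_prop : Continuous fun y => x - y))
  have hUo : IsOpen (G + G) := hGo.add_right
  have h0U : (0 : EuclideanSpace ℝ (Fin d)) ∈ G + G := ⟨0, h0, 0, h0, add_zero _⟩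
  have hgpos : ∀ x ∈ G + G, 0 < (g x).toReal := by
    rintro _ ⟨y, hy, z, hz, rfl⟩
    exact ENNReal.toReal_pos ((hSo _).measure_pos volume ⟨y, hy, by simpa using hz⟩).ne' (hgf _)
  have hg0 : ∀ x ∉ G + G, g x = 0 := by
    intro x hx
    have : {y | y ∈ G ∧ x - y ∈ G} = ∅ :=
      eq_empty_of_forall_notMem fun y hy => hx ⟨y, hy.1, x - y, hy.2, add_sub_cancel _ _⟩
    rw [hg, overlapVolume, this, measure_empty]
  have hconc : ConcaveOn ℝ (G + G) fun x => Real.log (g x).toReal := by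
    refine concaveOn_iff_forall_pos.2 ⟨hG.add hG, fun x hx y hy a b ha hb hab => ?_⟩
    have hBM : g x ^ a * g y ^ b ≤ g (a • x + b • y) := by
      refine volume_rpow_mul_rpow_le ha hb hab (hSo x).measurableSet (hSo y).measurableSet
        (hSo _).measurableSet fun w hw w' hw' => ⟨hG hw.1 hw'.1 ha.le hb.le hab, ?_⟩
      convert hG hw.2 hw'.2 ha.le hb.le hab using 1
      module
    have hreal := ENNReal.toReal_mono (hgf _) hBM
    rw [ENNReal.toReal_mul, ← ENNReal.toReal_rpow, ← ENNReal.toReal_rpow] at hreal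
    have hxp := hgpos x hx
    have hyp := hgpos y hy
    have := Real.log_le_log (by positivity) hreal
    rw [Real.log_mul (by positivity) (by positivity), Real.log_rpow hxp, Real.log_rpow hyp] at this
    exact this
  obtain ⟨u, hu⟩ := hconc.exists_le_add_continuousLinearMap hUo h0U
  set Φ : EuclideanSpace ℝ (Fin d) → ℝ≥0∞ := fun x => ENNReal.ofReal (Real.exp (-u x)) with hΦ
  have hΦm : Measurable Φ := by fun_prop
  have hpt : ∀ x, Φ x * g x ≤ (G + G).indicator (fun _ => g 0) x := by
    intro x
    by_cases hx : x ∈ G + G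
    · rw [indicator_of_mem hx]
      have h1 := hu x hx
      rw [sub_zero] at h1
      have h2 : (g x).toReal ≤ (g 0).toReal * Real.exp (u x) := by
        rw [← Real.exp_log (hgpos x hx), ← Real.exp_log (hgpos 0 h0U), ← Real.exp_add]
        exact Real.exp_le_exp.2 h1
      calc Φ x * g x = ENNReal.ofReal (Real.exp (-u x) * (g x).toReal) := by
            rw [ENNReal.ofReal_mul (Real.exp_pos _).le, ENNReal.ofReal_toReal (hgf x)]
        _ ≤ ENNReal.ofReal (g 0).toReal := by
            refine ENNReal.ofReal_le_ofReal ?_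
            calc Real.exp (-u x) * (g x).toReal
                ≤ Real.exp (-u x) * ((g 0).toReal * Real.exp (u x)) := by gcongr
              _ = (g 0).toReal := by
                rw [mul_left_comm, ← Real.exp_add, neg_add_cancel, Real.exp_zero, mul_one]
        _ = g 0 := ENNReal.ofReal_toReal (hgf 0)
    · rw [hg0 x hx, mul_zero]; exact zero_le
  have hsq : (∫⁻ x in G, Φ x) * (∫⁻ x in G, Φ x) = ∫⁻ x, Φ x * g x := by
    rw [lintegral_mul_overlapVolume hGm hGm hΦm, ← lintegral_mul_const _ hΦm]
    refine lintegral_congr fun y => ?_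
    rw [← lintegral_const_mul _ hΦm]
    refine lintegral_congr fun z => ?_
    simp only [hΦ]
    rw [← ENNReal.ofReal_mul (Real.exp_pos _).le, ← Real.exp_add, map_add, neg_add]
  have hle : (∫⁻ x in G, Φ x) * (∫⁻ x in G, Φ x) ≤
      g 0 * (ENNReal.ofReal (2 ^ d) * volume G) := by
    rw [hsq]
    refine (lintegral_mono hpt).trans_eq ?_
    have hGG : G + G = (2 : ℝ) • G := by
      have := hG.add_smul zero_le_one zero_le_one
      rw [one_smul, one_add_one_eq_two] at this
      exact this.symm
    rw [lintegral_indicator_const hUo.measurableSet, hGG,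
      Measure.addHaar_smul_of_nonneg _ (by norm_num), finrank_euclideanSpace_fin]
  have hexp : volume G ≤ ∫⁻ x in G, Φ x := by
    have hi : IntegrableOn (fun x => Real.exp (-u x)) G :=
      setIntegrable_of_continuous_of_isBounded hGb (by fun_prop)
    have hi' : IntegrableOn (fun x => u x) G :=
      setIntegrable_of_continuous_of_isBounded hGb (by fun_prop)
    have hi1 : IntegrableOn (fun _ : EuclideanSpace ℝ (Fin d) => (1 : ℝ)) G :=
      setIntegrable_of_continuous_of_isBounded hGb (by fun_prop)
    have h1 : volume.real G = ∫ x in G, (1 - u x) := by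
      rw [integral_sub hi1 hi', hcent u]
      simp
    rw [hΦ, ← ofReal_integral_eq_lintegral_ofReal hi (ae_of_all _ fun x => (Real.exp_pos _).le),
      ← ENNReal.ofReal_toReal hGf]
    refine ENNReal.ofReal_le_ofReal ?_
    change volume.real G ≤ _
    rw [h1]
    refine integral_mono (hi1.sub hi') hi fun x => ?_
    have := Real.add_one_le_exp (-u x)
    simp only
    linarith
  have hfin : volume G ≤ g 0 * ENNReal.ofReal (2 ^ d) := by
    have h1 : volume G * volume G ≤ g 0 * ENNReal.ofReal (2 ^ d) * volume G := by
      rw [mul_assoc]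
      exact (mul_le_mul' hexp hexp).trans hle
    exact (ENNReal.mul_le_mul_iff_left hGpos hGf).1 h1
  have hg00 : g 0 = volume (G ∩ -G) := by
    rw [hg, overlapVolume]
    congr 1
    ext y
    simp
  have hreal := ENNReal.toReal_mono (ENNReal.mul_ne_top (hgf 0) ENNReal.ofReal_ne_top) hfin
  rw [ENNReal.toReal_mul, ENNReal.toReal_ofReal (by positivity), hg00, mul_comm] at hreal
  exact hreal

/-! ### The centroid -/

section Centroid

variable {d : ℕ} {K : Set (EuclideanSpace ℝ (Fin d))}

theorem setIntegral_interior_eq (hK : Convex ℝ K) (f : EuclideanSpace ℝ (Fin d) → ℝ) :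
    ∫ x in interior K, f x = ∫ x in K, f x := by
  refine setIntegral_congr_set ?_
  refine (LE.le.eventuallyLE interior_subset).antisymm ?_
  refine ae_le_set.2 (measure_mono_null ?_ (hK.addHaar_frontier volume))
  exact fun x hx => ⟨subset_closure hx.1, hx.2⟩

theorem setIntegral_sub_centroidOf (hKc : IsCompact K) (hKi : (interior K).Nonempty)
    (u : EuclideanSpace ℝ (Fin d) →L[ℝ] ℝ) :
    ∫ x in K, u (x - centroidOf K) = 0 := by
  have hV : volume.real K ≠ 0 := (ENNReal.toReal_pos
    ((isOpen_interior.measure_pos volume hKi).trans_le (measure_mono interior_subset)).ne'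
    hKc.measure_lt_top.ne).ne'
  have hid : IntegrableOn (fun x : EuclideanSpace ℝ (Fin d) => x) K :=
    continuous_id.continuousOn.integrableOn_compact hKc
  have hc : volume.real K • centroidOf K = ∫ x in K, x := by
    rw [centroidOf, setAverage_eq, smul_inv_smul₀ hV]
  simp_rw [map_sub]
  rw [integral_sub (u.integrable_comp hid) (integrableOn_const hKc.measure_lt_top.ne),
    u.integral_comp_comm hid, ← hc, setIntegral_const, map_smul, sub_self]

theorem setIntegral_sub_singleton (K : Set (EuclideanSpace ℝ (Fin d)))
    (p : EuclideanSpace ℝ (Fin d)) (f : EuclideanSpace ℝ (Fin d) → ℝ) :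
    ∫ x in K - {p}, f x = ∫ x in K, f (x - p) := by
  have h := (measurePreserving_sub_right volume p).setIntegral_preimage_emb
    (MeasurableEquiv.subRight p).measurableEmbedding f (K - {p})
  rw [← h]
  congr 2
  ext x
  simp [Set.sub_singleton]

theorem setIntegral_sub_singleton_centroidOf (hKc : IsCompact K) (hKi : (interior K).Nonempty)
    (u : EuclideanSpace ℝ (Fin d) →L[ℝ] ℝ) :
    ∫ x in K - {centroidOf K}, u x = 0 := by
  rw [setIntegral_sub_singleton]
  exact setIntegral_sub_centroidOf hKc hKi u

/-- Otherwise a linear form separates the centroid from the interior, and its integral over `K`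
is too small. -/
theorem centroidOf_mem_interior (hK : Convex ℝ K) (hKc : IsCompact K)
    (hKi : (interior K).Nonempty) : centroidOf K ∈ interior K := by
  by_contra hc
  obtain ⟨u, hu⟩ := geometric_hahn_banach_open_point hK.interior isOpen_interior hc
  have h0 := setIntegral_sub_centroidOf hKc hKi (-u)
  rw [← setIntegral_interior_eq hK] at h0
  have hpos : ∀ x ∈ interior K, 0 < (-u) (x - centroidOf K) := by
    intro x hx
    have := hu x hx
    simp only [_root_.neg_apply, map_sub]
    linarith
  have := (setIntegral_pos_iff_support_of_nonneg_ae
    (f := fun x => (-u) (x - centroidOf K)) (μ := volume) (s := interior K)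
    (by
      filter_upwards [self_mem_ae_restrict isOpen_interior.measurableSet] with x hx
      exact (hpos x hx).le)
    (setIntegrable_of_continuous_of_isBounded (hKc.isBounded.subset interior_subset)
      (by fun_prop))).2 (by
      refine (isOpen_interior.measure_pos volume hKi).trans_le (measure_mono fun x hx => ?_)
      exact ⟨(hpos x hx).ne', hx⟩)
  exact this.ne' h0

/-- If the centroid of `K` is the origin, then `-K ⊆ 2 d • K`. Suppose `u ≤ b` on `K` and let
`x₀ ∈ K`. The copy of `K` shrunk towards `x₀` by the factor `1 - 1 / (2 d)` lies in `K` and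
has at least half of the volume; comparing the integrals of `b - u ≥ 0` over both gives
`-u x₀ ≤ 2 d b`. -/
theorem neg_subset_two_mul_smul (hd : 0 < d) (hK : Convex ℝ K) (hKc : IsCompact K)
    (h0 : (0 : EuclideanSpace ℝ (Fin d)) ∈ interior K)
    (hcent : ∀ u : EuclideanSpace ℝ (Fin d) →L[ℝ] ℝ, ∫ x in K, u x = 0) :
    -K ⊆ (2 * d : ℝ) • K := by
  intro x hx
  by_contra hxK
  have hd1 : (1 : ℝ) ≤ d := by exact_mod_cast hd
  have h0K : (0 : EuclideanSpace ℝ (Fin d)) ∈ K := interior_subset h0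
  obtain ⟨u, r, hur, hrx⟩ := geometric_hahn_banach_closed_point (hK.smul _)
    (hKc.smul (2 * d : ℝ)).isClosed hxK
  set x₀ := -x with hx₀
  have hx₀K : x₀ ∈ K := hx
  have hux : u x = -u x₀ := by rw [hx₀, map_neg, neg_neg]
  set b := r / (2 * d) with hb
  have hub : ∀ k ∈ K, u k ≤ b := by
    intro k hk
    have := hur _ (smul_mem_smul_set hk)
    rw [map_smul, smul_eq_mul] at this
    rw [hb, le_div_iff₀ (by positivity)]
    linarith
  have hb0 : 0 ≤ b := by simpa using hub 0 h0K
  have hV : 0 < volume.real K := ENNReal.toReal_pos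
    (Measure.measure_pos_of_mem_nhds _ (mem_interior_iff_mem_nhds.1 h0)).ne' hKc.measure_lt_top.ne
  set s : ℝ := 1 / (2 * d) with hs
  have hs0 : 0 < s := by positivity
  have hs1 : s ≤ 1 / 2 := by
    rw [hs]; gcongr; linarith
  have hint : ∀ f : EuclideanSpace ℝ (Fin d) → ℝ, Continuous f → IntegrableOn f K := fun f hf =>
    hf.continuousOn.integrableOn_compact hKc
  have hsub : (1 - s) • K - {-(s • x₀)} ⊆ K := by
    rintro _ ⟨_, ⟨k, hk, rfl⟩, _, rfl, rfl⟩
    simp only [sub_neg_eq_add]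
    exact hK hk hx₀K (by linarith) hs0.le (by ring)
  have hcomp : ∫ y in (1 - s) • K - {-(s • x₀)}, (b - u y) ≤ ∫ y in K, (b - u y) := by
    refine setIntegral_mono_set (hint _ (by fun_prop)) ?_ (LE.le.eventuallyLE hsub)
    filter_upwards [self_mem_ae_restrict hKc.measurableSet] with y hy
    exact sub_nonneg.2 (hub y hy)
  have hR : ∫ y in K, (b - u y) = volume.real K * b := by
    rw [integral_sub (hint _ continuous_const) (hint _ u.continuous), hcent, setIntegral_const]
    simp
  have hL : ∫ y in (1 - s) • K - {-(s • x₀)}, (b - u y) =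
      (1 - s) ^ d * (volume.real K * (b - s * u x₀)) := by
    rw [setIntegral_sub_singleton]
    have h1 := Measure.setIntegral_comp_smul_of_pos volume
      (fun y => b - u (y - -(s • x₀))) K (show 0 < 1 - s by linarith)
    rw [finrank_euclideanSpace_fin, smul_eq_mul, eq_inv_mul_iff_mul_eq₀
      (pow_pos (by linarith) _).ne'] at h1
    rw [← h1]
    congr 1
    have h2 : ∀ y, b - u ((1 - s) • y - -(s • x₀)) = (b - s * u x₀) - (1 - s) * u y := by
      intro y
      simp only [sub_neg_eq_add, map_add, map_smul, smul_eq_mul]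
      ring
    simp_rw [h2]
    rw [integral_sub (hint _ continuous_const) (hint _ (by fun_prop)), integral_const_mul, hcent,
      setIntegral_const]
    simp
  rw [hR, hL] at hcomp
  have hp : 1 / 2 ≤ (1 - s) ^ d := by
    have h1 := one_add_mul_le_pow (show (-2 : ℝ) ≤ -s by linarith) d
    have h2 : (d : ℝ) * s = 1 / 2 := by rw [hs]; field_simp
    rw [← sub_eq_add_neg] at h1
    linarith
  have hcomp' : (1 - s) ^ d * (b - s * u x₀) ≤ b := by
    refine le_of_mul_le_mul_left ?_ hV
    linarith
  have hfin : s * (-u x₀) ≤ b := by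
    by_contra! h
    have h1 : b + b < b - s * u x₀ := by linarith
    have h2 : 1 / 2 * (b - s * u x₀) ≤ (1 - s) ^ d * (b - s * u x₀) := by
      gcongr
      linarith
    linarith
  rw [hs, one_div, inv_mul_le_iff₀ (by positivity), hb, mul_div_cancel₀ _ (by positivity)] at hfin
  linarith

theorem exists_kappa_centroidOf_eq (hd : 2 ≤ d) (hK : Convex ℝ K) (hKc : IsCompact K)
    (hKi : (interior K).Nonempty) :
    ∃ n : ℕ, kappa K (centroidOf K) = n ∧
      (n : ℝ) ≤ (3 : ℝ) ^ d * ((2 * d).choose d : ℝ) *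
        (12 * Real.exp (8 / 3) * (d * Real.log d)) := by
  set c := centroidOf K with hc
  have hci : c ∈ interior K := centroidOf_mem_interior hK hKc hKi
  have hK0 : Convex ℝ (K - {c}) := hK.sub (convex_singleton c)
  have hKc0 : IsCompact (K - {c}) := by
    rw [sub_singleton_eq_neg_vadd]; exact hKc.vadd _
  have h0 := zero_mem_interior_sub_singleton hci
  have hcent := setIntegral_sub_singleton_centroidOf hKc hKi
  have hd2 : (2 : ℝ) ≤ d := by exact_mod_cast hd
  have hθ : {c} - K ⊆ (2 * d : ℝ) • (K - {c}) := by
    rw [← neg_sub_singleton]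
    exact neg_subset_two_mul_smul (by lia) hK0 hKc0 h0 hcent
  obtain ⟨n, hn, hle⟩ := exists_kappa_eq_of_neg_subset hd hK hKc hci (by linarith) hθ
  refine ⟨n, hn, hle.trans ?_⟩
  have hRS := volume_real_sub_self_le (by lia) hK hKc hKi
  have hVK : volume.real (interior (K - {c})) = volume.real K := by
    rw [Measure.real, hK0.measure_interior, sub_singleton_eq_neg_vadd, measure_vadd, Measure.real]
  have hMP : volume.real K ≤ 2 ^ d * volume.real ((K - {c}) ∩ ({c} - K)) := by
    have h1 := volume_real_le_two_pow_mul_inter_neg hK0.interior isOpen_interior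
      (hKc0.isBounded.subset interior_subset) h0
      fun u => (setIntegral_interior_eq hK0 _).trans (hcent u)
    rw [hVK] at h1
    refine h1.trans ?_
    gcongr
    · exact ((measure_mono inter_subset_left).trans_lt hKc0.measure_lt_top).ne
    · exact interior_subset
    · rw [← neg_sub_singleton]
      exact Set.neg_subset_neg.2 interior_subset
  have hS : 0 < volume.real ((K - {c}) ∩ ({c} - K)) := by
    rw [← neg_sub_singleton]; exact volume_real_inter_neg_pos hKc0 h0
  have hlog : Real.log d + Real.log (2 * d) ≤ 3 * Real.log d := by
    have h1 : Real.log (2 * d) ≤ Real.log ((d : ℝ) ^ 2) :=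
      Real.log_le_log (by positivity) (by nlinarith)
    rw [Real.log_pow] at h1
    push_cast at h1
    linarith
  rw [div_le_iff₀ hS]
  calc 4 * d * (Real.log d + Real.log (2 * d)) *
        ((3 / 2 : ℝ) ^ d * Real.exp (8 / 3) * volume.real (K - K))
      ≤ 4 * d * (3 * Real.log d) * ((3 / 2 : ℝ) ^ d * Real.exp (8 / 3) *
        (((2 * d).choose d : ℕ) * (2 ^ d * volume.real ((K - {c}) ∩ ({c} - K))))) := by
        have h1 : 0 ≤ Real.log d := Real.log_natCast_nonneg d
        have h2 := hRS.trans (mul_le_mul_of_nonneg_left hMP (Nat.cast_nonneg _))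
        gcongr
    _ = (3 / 2 * 2 : ℝ) ^ d * ((2 * d).choose d : ℝ) * (12 * Real.exp (8 / 3) *
          (d * Real.log d)) * volume.real ((K - {c}) ∩ ({c} - K)) := by
        rw [mul_pow]; ring
    _ = _ := by norm_num

end Centroid

/-! ### Bounds for `kappa` and `kappaStrict` -/

theorem theorem1p3 :
    (∀ (d : ℕ) (K : Set (EuclideanSpace ℝ (Fin d))) (p : EuclideanSpace ℝ (Fin d)),
      Convex ℝ K → IsCompact K → p ∈ interior K → kappaStrict K p ≤ kappa K p) ∧
    (∃ C : ℝ, 0 < C ∧ ∀ d : ℕ, 2 ≤ d →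
      ∀ (K : Set (EuclideanSpace ℝ (Fin d))) (p : EuclideanSpace ℝ (Fin d)),
        Convex ℝ K → IsCompact K → p ∈ interior K →
        ∃ n : ℕ, kappa K p = n ∧
          (n : ℝ) ≤ (3 / 2 : ℝ) ^ d *
            (volume.real (K - K) / volume.real ((K - {p}) ∩ ({p} - K))) *
            (C * (d * (Real.log d + Real.log (asymmetry K p))))) ∧
    (∃ C : ℝ, 0 < C ∧ ∀ d : ℕ, 2 ≤ d →
      ∀ K : Set (EuclideanSpace ℝ (Fin d)),
        Convex ℝ K → IsCompact K → (interior K).Nonempty →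
        kappaStrict K (centroidOf K) ≤ kappa K (centroidOf K) ∧
        ∃ n : ℕ, kappa K (centroidOf K) = n ∧
          (n : ℝ) ≤ (3 : ℝ) ^ d * ((2 * d).choose d : ℝ) * (C * (d * Real.log d))) := by
  exact ⟨fun _ K p _ _ _ => kappaStrict_le_kappa K p,
    ⟨8 * Real.exp (8 / 3), by positivity, fun d hd K p hK hKc hp =>
      exists_kappa_eq_of_asymmetry hd hK hKc hp⟩,
    ⟨12 * Real.exp (8 / 3), by positivity, fun d hd K hK hKc hKi =>
      ⟨kappaStrict_le_kappa K _, exists_kappa_centroidOf_eq hd hK hKc hKi⟩⟩⟩
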